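/- Let $G$ be a finite group and let $\Theta=\sum_{H\le G} n_H H$ be a Brauer relation in $G$, i.e. a formal $\mathbb Z$-linear combination of subgroups of $G$ such that the virtual permutation representation $\sum_H n_H\,\mathbb Q[G/H]$ is zero. For a finitely generated $\mathbb Z[G]$-module $M$ (possibly with torsion) and a field $L\supseteq\mathbb Q$, let $\langle\cdot,\cdot\rangle: M\times M\to L$ be a $G$-invariant $\mathbb Z$-bilinear pairing that is non-degenerate on $M$ modulo torsion (that is, its Gram determinant on a $\mathbb Z$-basis of $M/M_{\mathrm{tors}}$ is non-zero). Such a pairing exists already for $L=\mathbb Q$. The regulator constant of $M$ is $$C_\Theta(M)=\prod_{H\le G}\left(\frac{1}{|(M_{\mathrm{tors}})^H|^{2}}\det\left(\frac1{|H|}\langle\cdot,\cdot\rangle\Big|_{M^H/(M^H)_{\mathrm{tors}}}\right)\right)^{n_H},$$ the determinant being computed on any $\mathbb Z$-basis of $M^H/(M^H)_{\mathrm{tors}}$. This is a non-zero rational number which does not depend on $L$ or on the choice of the pairing. Let $$0\to M'\xrightarrow{f} M\xrightarrow{g} M''\to 0$$ be an exact sequence of finitely generated $\mathbb Z[G]$-modules.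 Then $$C_\Theta(M)=C_\Theta(M')\,C_\Theta(M'')\,\psi_\Theta(f)^2,\qquad \psi_\Theta(f)=\prod_{H\le G}\left|\ker\left(H^1(H,f):H^1(H,M')\to H^1(H,M)\right)\right|^{n_H}.$$ In particular, if the exact sequence splits (as a sequence of $\mathbb Z[G]$-modules), then $C_\Theta(M)=C_\Theta(M')\,C_\Theta(M'')$. -/

import Mathlib

open CategoryTheory
open scoped DirectSum

universe w v

noncomputable section

namespace RegulatorConstant

/-! ### Brauer relations -/

section Brauer

variable {G : Type} [Group G]

/-- The rational permutation representation `⨁_H ℚ[G/H] ^ m(H)` attached to a family of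
multiplicities `m(H) ∈ ℕ`, indexed by the subgroups `H ≤ G`. -/
def permRep (m : Subgroup G → ℕ) :
    Representation ℚ G (⨁ p : (Σ H : Subgroup G, Fin (m H)), MonoidAlgebra ℚ (G ⧸ p.1)) :=
  Representation.directSum fun p : (Σ H : Subgroup G, Fin (m H)) =>
    Representation.ofMulAction ℚ G (G ⧸ p.1)

/-- A formal linear combination `∑_H n_H H` of subgroups of `G` is a Brauer relation if the virtual
permutation representation `∑_H n_H ℚ[G/H]` is zero, i.e. if its positive part
`⨁_{n_H > 0} ℚ[G/H] ^ n_H` and its negative part `⨁_{n_H < 0} ℚ[G/H] ^ (-n_H)` are isomorphic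
representations of `G`. -/
def IsBrauerRelation (Θ : Subgroup G →₀ ℤ) : Prop :=
  Nonempty ((permRep fun H => (Θ H).toNat).Equiv (permRep fun H => (-Θ H).toNat))

end Brauer

/-! ### Gram determinants modulo torsion -/

section Gram

variable {N : Type w} [AddCommGroup N] {L : Type v} [Field L] [CharZero L]

/-- A bilinear map with values in a field of characteristic zero kills torsion on the left. -/
theorem apply_torsion (B : N →ₗ[ℤ] N →ₗ[ℤ] L) {t : N} (ht : t ∈ Submodule.torsion ℤ N) :
    B t = 0 := by
  obtain ⟨a, ha⟩ := (Submodule.mem_torsion_iff t).1 ht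
  ext y
  have h : (a : ℤ) • B t y = 0 := by
    rw [← LinearMap.smul_apply, ← map_smul]
    have : ((a : ℤ) • t : N) = 0 := ha
    rw [this]; simp
  rcases smul_eq_zero.1 h with h | h
  · exact absurd h (nonZeroDivisors.coe_ne_zero a)
  · simpa using h

/-- A bilinear map with values in a field of characteristic zero kills torsion on the right. -/
theorem apply_torsion_right (B : N →ₗ[ℤ] N →ₗ[ℤ] L) (x : N) {t : N}
    (ht : t ∈ Submodule.torsion ℤ N) : B x t = 0 := by
  have := apply_torsion B.flip ht
  simpa using LinearMap.congr_fun this x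

/-- The pairing induced by `B` on `N` modulo torsion. -/
def modTorsion (B : N →ₗ[ℤ] N →ₗ[ℤ] L) :
    (N ⧸ Submodule.torsion ℤ N) →ₗ[ℤ] (N ⧸ Submodule.torsion ℤ N) →ₗ[ℤ] L :=
  (Submodule.torsion ℤ N).liftQ
    (LinearMap.flip ((Submodule.torsion ℤ N).liftQ B.flip
      fun t ht => by
        rw [LinearMap.mem_ker]
        ext x
        exact apply_torsion_right B x ht))
    fun t ht => by
      rw [LinearMap.mem_ker]
      ext x
      exact LinearMap.congr_fun (apply_torsion B ht) x

@[simp]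
theorem modTorsion_mk (B : N →ₗ[ℤ] N →ₗ[ℤ] L) (x y : N) :
    modTorsion B (Submodule.Quotient.mk x) (Submodule.Quotient.mk y) = B x y := rfl

/-- The determinant `det (c • B)` of the pairing `c • B` on a `ℤ`-basis of `N` modulo torsion. -/
def gramDet [Module.Finite ℤ N] (c : L) (B : N →ₗ[ℤ] N →ₗ[ℤ] L) : L :=
  (Matrix.of fun i j => c * modTorsion B
    (Module.finBasis ℤ (N ⧸ Submodule.torsion ℤ N) i)
    (Module.finBasis ℤ (N ⧸ Submodule.torsion ℤ N) j)).det

/-- The Gram determinant can be computed on any `ℤ`-basis of `N` modulo torsion. -/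
theorem gramDet_eq [Module.Finite ℤ N] (c : L) (B : N →ₗ[ℤ] N →ₗ[ℤ] L)
    {ι : Type*} [Fintype ι] [DecidableEq ι]
    (b : Module.Basis ι ℤ (N ⧸ Submodule.torsion ℤ N)) :
    gramDet c B = (Matrix.of fun i j => c * modTorsion B (b i) (b j)).det := by
  classical
  let b₀ := Module.finBasis ℤ (N ⧸ Submodule.torsion ℤ N)
  let e : Fin (Module.finrank ℤ (N ⧸ Submodule.torsion ℤ N)) ≃ ι := b₀.indexEquiv b
  let b₁ := b₀.reindex e
  have h₀ : gramDet c B = (Matrix.of fun i j => c * modTorsion B (b₁ i) (b₁ j)).det := by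
    rw [gramDet, ← Matrix.det_reindex_self e]
    congr 1
    ext i j
    simp [b₁, b₀]
  let P : Matrix ι ι ℤ := b.toMatrix b₁
  have hP : P.det * P.det = 1 := by
    have hu : IsUnit P.det := by
      have h := b.toMatrix_mul_toMatrix_flip b₁
      have h2 := congrArg Matrix.det h
      rw [Matrix.det_mul, Matrix.det_one] at h2
      exact IsUnit.of_mul_eq_one _ h2
    rcases Int.isUnit_iff.1 hu with h | h <;> rw [h] <;> norm_num
  have hb : ∀ j, b₁ j = ∑ i, P i j • b i := fun j => (b.sum_toMatrix_smul_self b₁ j).symm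
  let Q : Matrix ι ι L := P.map (Int.castRingHom L)
  have hQ : Q.det = ((P.det : ℤ) : L) := by
    simpa [Q] using (RingHom.map_det (Int.castRingHom L) P).symm
  have hmat : (Matrix.of fun i j => c * modTorsion B (b₁ i) (b₁ j)) =
      Q.transpose * (Matrix.of fun i j => c * modTorsion B (b i) (b j)) * Q := by
    ext i j
    rw [Matrix.of_apply, hb i, hb j]
    simp only [map_sum, map_smul, LinearMap.sum_apply, LinearMap.smul_apply, Matrix.mul_apply,
      Matrix.of_apply, Matrix.transpose_apply, Q, Matrix.map_apply, Finset.mul_sum,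
      Finset.sum_mul, Finset.smul_sum, zsmul_eq_mul, eq_intCast]
    refine Finset.sum_congr rfl fun k _ => Finset.sum_congr rfl fun l _ => ?_
    ring
  rw [h₀, hmat, Matrix.det_mul, Matrix.det_mul, Matrix.det_transpose, hQ, mul_right_comm,
    ← Int.cast_mul, hP, Int.cast_one, one_mul]

end Gram

/-! ### Regulator constants -/

section RC

variable {G : Type} [Group G] {M : Type w} [AddCommGroup M]

/-- For a finite group `G`, a `ℤ[G]`-module is finitely generated if and only if its underlying
abelian group is. -/
theorem finite_iff [Finite G] (ρ : Representation ℤ G M) :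
    Module.Finite (MonoidAlgebra ℤ G) ρ.asModule ↔ Module.Finite ℤ M := by
  constructor
  · intro h
    have h2 : Module.Finite ℤ ρ.asModule := Module.Finite.trans (MonoidAlgebra ℤ G) _
    exact h2
  · intro h
    have h2 : Module.Finite ℤ ρ.asModule := h
    exact Module.Finite.of_restrictScalars_finite ℤ (MonoidAlgebra ℤ G) ρ.asModule

/-- The submodule `M^H` of the elements of `M` fixed by the subgroup `H`. -/
abbrev fixed (ρ : Representation ℤ G M) (H : Subgroup G) : Submodule ℤ M :=
  Representation.invariants (ρ.comp H.subtype : Representation ℤ H M)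

/-- A `G`-invariant bilinear pairing on `M` with values in an extension `L` of `ℚ`, non-degenerate
on `M` modulo torsion: its Gram matrix on a `ℤ`-basis of `M` modulo torsion is invertible. -/
structure Pairing [Module.Finite ℤ M] (ρ : Representation ℤ G M)
    (L : Type v) [Field L] [CharZero L] where
  /-- the underlying bilinear map -/
  toBilin : M →ₗ[ℤ] M →ₗ[ℤ] L
  invariant : ∀ (g : G) (x y : M), toBilin (ρ g x) (ρ g y) = toBilin x y
  nondegenerate : gramDet 1 toBilin ≠ 0

/-- The regulator constant of `M` with respect to `Θ = ∑_H n_H H`, computed with the pairing `B`: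
`∏_H (#(M_tors ^ H) ^ (-2) * det ((1 / #H) B | M^H modulo torsion)) ^ n_H`. -/
def regConstOf [Module.Finite ℤ M] (Θ : Subgroup G →₀ ℤ) (ρ : Representation ℤ G M)
    {L : Type v} [Field L] [CharZero L] (B : Pairing ρ L) : L :=
  Θ.prod fun H n =>
    (1 / (Nat.card ↥(Submodule.torsion ℤ M ⊓ fixed ρ H) : L) ^ 2 *
      gramDet (1 / (Nat.card H : L))
        (B.toBilin.domRestrict₁₂ (fixed ρ H) (fixed ρ H))) ^ n

/-- Every finitely generated module over the integral group ring of a finite group has a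
`ℚ`-valued pairing. -/
theorem nonempty_pairing [Finite G] [Module.Finite ℤ M] (ρ : Representation ℤ G M) :
    Nonempty (Pairing ρ ℚ) := by
  classical
  have := Fintype.ofFinite G
  let T := Submodule.torsion ℤ M
  let b := Module.finBasis ℤ (M ⧸ T)
  let c : Fin (Module.finrank ℤ (M ⧸ T)) → M →ₗ[ℤ] ℤ := fun i => b.coord i ∘ₗ T.mkQ
  let A : M →ₗ[ℤ] M →ₗ[ℤ] ℤ := ∑ g : G, ∑ i,
    (LinearMap.mul ℤ ℤ).compl₁₂ (c i ∘ₗ ρ g) (c i ∘ₗ ρ g)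
  have hA : ∀ x y, A x y = ∑ g : G, ∑ i, c i (ρ g x) * c i (ρ g y) := fun x y => by
    simp [A, LinearMap.sum_apply]
  have hAinv : ∀ (h : G) (x y : M), A (ρ h x) (ρ h y) = A x y := fun h x y => by
    rw [hA, hA]
    refine Fintype.sum_equiv (Equiv.mulRight h) _ _ fun g => ?_
    simp [map_mul]
  have hApos : ∀ x : M, A x x = 0 → T.mkQ x = 0 := fun x hx => by
    rw [hA] at hx
    have h1 := (Finset.sum_eq_zero_iff_of_nonneg fun g _ =>
      Finset.sum_nonneg fun i _ => mul_self_nonneg (c i (ρ g x))).1 hx 1 (Finset.mem_univ _)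
    have h2 := (Finset.sum_eq_zero_iff_of_nonneg fun i _ =>
      mul_self_nonneg (c i (ρ 1 x))).1 h1
    refine b.ext_elem fun i => ?_
    have h3 := mul_self_eq_zero.1 (h2 i (Finset.mem_univ _))
    simpa [c] using h3
  let B : M →ₗ[ℤ] M →ₗ[ℤ] ℚ := A.compr₂ (Algebra.linearMap ℤ ℚ)
  have hB : ∀ x y, B x y = ((A x y : ℤ) : ℚ) := fun x y => by simp [B]
  refine ⟨⟨B, fun g x y => by rw [hB, hB, hAinv], fun h0 => ?_⟩⟩
  choose m hm using fun i => Submodule.Quotient.mk_surjective T (b i)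
  let D : Matrix _ _ ℤ := Matrix.of fun i j => A (m i) (m j)
  have hD : D.det = 0 := by
    have h1 : gramDet 1 B = ((D.det : ℤ) : ℚ) := by
      have h2 := RingHom.map_det (Int.castRingHom ℚ) D
      rw [eq_intCast] at h2
      rw [h2, gramDet]
      congr 1
      ext i j
      rw [Matrix.of_apply, one_mul]
      change modTorsion B (b i) (b j) = _
      rw [← hm i, ← hm j, modTorsion_mk, hB]
      simp [D]
    rw [h1] at h0
    exact_mod_cast h0
  obtain ⟨v, hv, hDv⟩ := Matrix.exists_mulVec_eq_zero_iff.2 hD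
  let x : M := ∑ i, v i • m i
  have hx : A x x = 0 := by
    have h1 : ∀ i, A (m i) x = 0 := fun i => by
      have := congrFun hDv i
      simp only [Matrix.mulVec, dotProduct, D, Matrix.of_apply, Pi.zero_apply] at this
      rw [← this]
      simp [x, mul_comm]
    have h2 : A x x = ∑ i, v i * A (m i) x := by
      conv_lhs => enter [1]; rw [show x = ∑ i, v i • m i from rfl]
      simp only [map_sum, map_smul, LinearMap.sum_apply, LinearMap.smul_apply, smul_eq_mul]
    rw [h2]
    simp [h1]
  have h3 : ∑ i, v i • b i = 0 := by
    have := hApos x hx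
    simp only [x, map_sum, map_smul, Submodule.mkQ_apply, hm] at this
    exact this
  exact hv (funext fun i => Fintype.linearIndependent_iff.1 b.linearIndependent v h3 i)

/-- The regulator constant `C_Θ(M) ∈ ℚ` of `M` with respect to `Θ`, computed with some `ℚ`-valued
pairing. -/
def regConst [Finite G] [Module.Finite ℤ M] (Θ : Subgroup G →₀ ℤ) (ρ : Representation ℤ G M) : ℚ :=
  regConstOf Θ ρ (nonempty_pairing ρ).some

end RC

/-! ### The defect -/

section Psi

variable {G : Type} [Group G] {M' M : Type} [AddCommGroup M'] [AddCommGroup M]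
  {ρ' : Representation ℤ G M'} {ρ : Representation ℤ G M}

/-- The map `H¹(H, f) : H¹(H, M') → H¹(H, M)` induced by a homomorphism `f : M' → M`. -/
def mapH1 (f : ρ'.IntertwiningMap ρ) (H : Subgroup G) :
    groupCohomology (Rep.res H.subtype (Rep.of ρ')) 1 ⟶
      groupCohomology (Rep.res H.subtype (Rep.of ρ)) 1 :=
  groupCohomology.map (MonoidHom.id H) ((Rep.resFunctor H.subtype).map (Rep.ofHom f)) 1

/-- `ψ_Θ(f) = ∏_H #ker (H¹(H, M') → H¹(H, M)) ^ n_H` for `f : M' → M`. -/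
def psi (Θ : Subgroup G →₀ ℤ) (f : ρ'.IntertwiningMap ρ) : ℚ :=
  Θ.prod fun H n => (Nat.card (LinearMap.ker (mapH1 f H).hom) : ℚ) ^ n

end Psi

end RegulatorConstant

end

/-! The formula holds subgroup by subgroup once the pairing on `M` is well chosen. Averaging over
`G` gives an equivariant `s : M'' → M` with `g ∘ s = n` for some integer `n ≠ 0` (`exists_section`),
so over `ℚ` the sequence splits, and invariant pairings on `M'` and `M''` glue to one on `M` for
which `f(M')` and `s(M'')` are orthogonal (`exists_pairings`). For each `H` the sequence `0 → M'^H →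
M^H → M''^H` is exact, and its last map has image of finite index `k_H`. Comparing Gram determinants
on sublattices of finite index (`gramDet_exact`) shows that the factor of `M` at `H` is the product
of those of `M'` and `M''`, times `k_H ^ 2`. The long exact cohomology sequence identifies `M''^H /
g(M^H)` with the kernel of `H¹(H, f)` (`card_ker_map_H1`), so the product of the `k_H ^ n_H` is
`ψ_Θ(f)`.

The Brauer relation provides the freedom to choose the pairing (`IsBrauerRelation.regConstOf_eq`).
Two pairings differ by a `G`-endomorphism `φ` of `V = Hom(M, L)`, and their Gram determinants on
`M^H` differ by the factor `det (φ | V^H)` (`Pairing.gramDet_onFixed`). As `V^H = Hom_G(ℚ[G/H], V)`,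
the product of these determinants over the positive part of `Θ`, and likewise over the negative
part, is the determinant of `φ` acting on `Hom_G(P, V)`, with `P` the corresponding permutation
representation. The two `P` are isomorphic, so the two products agree
(`IsBrauerRelation.prod_det_eq`). -/

noncomputable section

namespace RegulatorConstant

/-! ### Gram determinants of sublattices of finite index, in the presence of torsion. -/

section Lattice

/-- The index of a subgroup and the indices of its intersection with the kernel of a homomorphism
and of its image. -/
theorem index_mul_index_range {A C : Type*} [AddCommGroup A] [AddCommGroup C] (g : A →+ C)
    (F : AddSubgroup A) :
    F.index * g.range.index = F.relIndex g.ker * (F.map g).index := by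
  have h : F.relIndex (F ⊔ g.ker) = F.relIndex g.ker := by
    rw [sup_comm, AddSubgroup.relIndex_sup_right]
  rw [AddSubgroup.index_map, ← AddSubgroup.relIndex_mul_index (le_sup_left : F ≤ F ⊔ g.ker), h,
    mul_assoc]

variable {N : Type w} [AddCommGroup N] {L : Type v} [Field L] [CharZero L] [Module.Finite ℤ N]

/-- The Gram determinant of a family of vectors, as many as the rank. -/
theorem det_gram_eq (c : L) (B : N →ₗ[ℤ] N →ₗ[ℤ] L) {ι : Type*} [Fintype ι] [DecidableEq ι]
    (e : Module.Basis ι ℤ (N ⧸ Submodule.torsion ℤ N)) (b : ι → N) :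
    (Matrix.of fun i j => c * B (b i) (b j)).det =
      gramDet c B * ((e.det fun i => (Submodule.torsion ℤ N).mkQ (b i) : ℤ) : L) ^ 2 := by
  let u : ι → N ⧸ Submodule.torsion ℤ N := fun i => (Submodule.torsion ℤ N).mkQ (b i)
  let P : Matrix ι ι ℤ := e.toMatrix u
  have hb : ∀ j, u j = ∑ i, P i j • e i := fun j => (e.sum_toMatrix_smul_self u j).symm
  let Q : Matrix ι ι L := P.map (Int.castRingHom L)
  have hQ : Q.det = ((P.det : ℤ) : L) := by
    simpa [Q] using (RingHom.map_det (Int.castRingHom L) P).symm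
  have hmat : (Matrix.of fun i j => c * B (b i) (b j)) =
      Q.transpose * (Matrix.of fun i j => c * modTorsion B (e i) (e j)) * Q := by
    ext i j
    rw [Matrix.of_apply, show B (b i) (b j) = modTorsion B (u i) (u j) from rfl, hb i, hb j]
    simp only [map_sum, map_smul, LinearMap.sum_apply, LinearMap.smul_apply, Matrix.mul_apply,
      Matrix.of_apply, Matrix.transpose_apply, Q, Matrix.map_apply, Finset.mul_sum,
      Finset.sum_mul, Finset.smul_sum, zsmul_eq_mul, eq_intCast]
    refine Finset.sum_congr rfl fun k _ => Finset.sum_congr rfl fun l _ => ?_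
    ring
  rw [hmat, Matrix.det_mul, Matrix.det_mul, Matrix.det_transpose, hQ, gramDet_eq c B e,
    Module.Basis.det_apply]
  ring

variable {ι : Type*} [Fintype ι]

omit [Module.Finite ℤ N] in
-- A relation modulo torsion becomes a true relation after multiplication by a non-zero integer.
theorem linearIndependent_mkQ_torsion {b : ι → N} (hb : LinearIndependent ℤ b) :
    LinearIndependent ℤ fun i => (Submodule.torsion ℤ N).mkQ (b i) := by
  rw [Fintype.linearIndependent_iff] at hb ⊢
  intro a ha
  have h : ∑ i, a i • b i ∈ Submodule.torsion ℤ N := by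
    rw [← Submodule.Quotient.mk_eq_zero, ← Submodule.mkQ_apply]
    simpa using ha
  obtain ⟨m, hm⟩ := (Submodule.mem_torsion_iff _).1 h
  have hm' : ∑ i, ((m : ℤ) * a i) • b i = 0 := by
    simp only [mul_smul, ← Finset.smul_sum]; exact hm
  intro i
  exact (mul_eq_zero.1 (hb _ hm' i)).resolve_left (nonZeroDivisors.coe_ne_zero m)

omit [Module.Finite ℤ N] in
theorem span_inf_torsion {b : ι → N} (hb : LinearIndependent ℤ b) :
    Submodule.span ℤ (Set.range b) ⊓ Submodule.torsion ℤ N = ⊥ := by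
  rw [eq_bot_iff]
  rintro x ⟨hx, ht⟩
  obtain ⟨a, rfl⟩ := (Submodule.mem_span_range_iff_exists_fun ℤ).1 hx
  rw [SetLike.mem_coe] at ht
  have h := (Fintype.linearIndependent_iff.1 (linearIndependent_mkQ_torsion hb)) a (by
    rw [← Submodule.Quotient.mk_eq_zero, ← Submodule.mkQ_apply] at ht
    simpa using ht)
  simp [h]

omit [Module.Finite ℤ N] in
-- The span meets the torsion trivially, so the index formula for the projection modulo torsion
-- contributes the full order of the torsion.
theorem index_span {b : ι → N} (hb : LinearIndependent ℤ b) :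
    (Submodule.span ℤ (Set.range b)).toAddSubgroup.index =
      Nat.card (Submodule.torsion ℤ N) * (Submodule.span ℤ (Set.range fun i =>
        (Submodule.torsion ℤ N).mkQ (b i))).toAddSubgroup.index := by
  set T := Submodule.torsion ℤ N
  set F := Submodule.span ℤ (Set.range b)
  have h := index_mul_index_range T.mkQ.toAddMonoidHom F.toAddSubgroup
  have h1 : T.mkQ.toAddMonoidHom.range = ⊤ := by
    rw [AddMonoidHom.range_eq_top]; exact T.mkQ_surjective
  have h2 : T.mkQ.toAddMonoidHom.ker = T.toAddSubgroup := by
    ext x; simp [AddMonoidHom.mem_ker]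
  have h3 : F.toAddSubgroup.map T.mkQ.toAddMonoidHom = (Submodule.span ℤ (Set.range fun i =>
        T.mkQ (b i))).toAddSubgroup := by
    have : (Set.range fun i => T.mkQ (b i)) = T.mkQ '' Set.range b := by
      rw [← Set.range_comp]; rfl
    rw [this, Submodule.span_image]
    rfl
  have h4 : F.toAddSubgroup.relIndex T.toAddSubgroup = Nat.card T := by
    have h5 : F.toAddSubgroup ⊓ T.toAddSubgroup = ⊥ := by
      ext x
      exact SetLike.ext_iff.1 (span_inf_torsion hb) x
    rw [← AddSubgroup.inf_relIndex_right, h5, AddSubgroup.relIndex_bot_left]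
    rfl
  rw [h1, h2, h3, h4, AddSubgroup.index_top, mul_one] at h
  exact h

/-- The Gram determinant of a linearly independent family spanning a subgroup of finite index. -/
theorem det_gram_mul_card_sq [DecidableEq ι] (c : L) (B : N →ₗ[ℤ] N →ₗ[ℤ] L)
    {b : ι → N} (hb : LinearIndependent ℤ b)
    (hi : (Submodule.span ℤ (Set.range b)).toAddSubgroup.index ≠ 0) :
    (Matrix.of fun i j => c * B (b i) (b j)).det * (Nat.card (Submodule.torsion ℤ N) : L) ^ 2 =
      gramDet c B * ((Submodule.span ℤ (Set.range b)).toAddSubgroup.index : L) ^ 2 := by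
  have hu := linearIndependent_mkQ_torsion hb
  rw [index_span hb] at hi ⊢
  set u : ι → N ⧸ Submodule.torsion ℤ N := fun i => (Submodule.torsion ℤ N).mkQ (b i)
  set S := Submodule.span ℤ (Set.range u)
  have hfin : Finite ((N ⧸ Submodule.torsion ℤ N) ⧸ S) :=
    AddSubgroup.index_ne_zero_iff_finite.1 (right_ne_zero_of_mul hi)
  have hrank := S.finiteQuotient_iff.1 hfin
  let bS : Module.Basis ι ℤ S := Module.Basis.span hu
  let e₀ := Module.finBasis ℤ (N ⧸ Submodule.torsion ℤ N)
  -- Finite index forces the family to have as many members as the rank, so a basis of the quotient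
  -- can be indexed by `ι`; the index is then the absolute value of a determinant.
  let e : Module.Basis ι ℤ (N ⧸ Submodule.torsion ℤ N) := e₀.reindex
    ((Fintype.equivFinOfCardEq (by
      rw [← hrank, Module.finrank_eq_card_basis bS])).symm)
  have h1 : S.toAddSubgroup.index = (e.det u).natAbs := by
    rw [AddSubgroup.index_eq_natAbs_det e S.toAddSubgroup bS]
    congr 2
    ext i
    exact congrArg Subtype.val (Module.Basis.span_apply hu i)
  rw [det_gram_eq c B e b, h1]
  have h2 : (((e.det u).natAbs : L)) ^ 2 = ((e.det u : ℤ) : L) ^ 2 := by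
    have : (((e.det u).natAbs : ℤ)) ^ 2 = (e.det u : ℤ) ^ 2 := Int.natAbs_sq _
    have := congrArg (Int.cast : ℤ → L) this
    rw [Int.cast_pow, Int.cast_pow, Int.cast_natCast] at this
    exact this
  push_cast
  rw [mul_pow, h2]
  ring

instance finite_torsion : Finite (Submodule.torsion ℤ N) :=
  Module.finite_of_fg_torsion _ (Submodule.torsion_isTorsion)

variable (N) in
/-- A lift to `N` of a basis of `N` modulo torsion. -/
def liftBasis : Fin (Module.finrank ℤ (N ⧸ Submodule.torsion ℤ N)) → N := fun i =>
  (Submodule.Quotient.mk_surjective _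
    (Module.finBasis ℤ (N ⧸ Submodule.torsion ℤ N) i)).choose

variable (N) in
theorem mkQ_liftBasis (i) : (Submodule.torsion ℤ N).mkQ (liftBasis N i) =
    Module.finBasis ℤ (N ⧸ Submodule.torsion ℤ N) i :=
  (Submodule.Quotient.mk_surjective _
    (Module.finBasis ℤ (N ⧸ Submodule.torsion ℤ N) i)).choose_spec

variable (N) in
theorem linearIndependent_liftBasis : LinearIndependent ℤ (liftBasis N) := by
  refine LinearIndependent.of_comp (Submodule.torsion ℤ N).mkQ ?_
  rw [show (Submodule.torsion ℤ N).mkQ ∘ liftBasis N =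
    Module.finBasis ℤ (N ⧸ Submodule.torsion ℤ N) from funext (mkQ_liftBasis N)]
  exact (Module.finBasis ℤ (N ⧸ Submodule.torsion ℤ N)).linearIndependent

variable (N) in
theorem index_span_liftBasis :
    (Submodule.span ℤ (Set.range (liftBasis N))).toAddSubgroup.index ≠ 0 := by
  rw [index_span (linearIndependent_liftBasis N)]
  simp only [mkQ_liftBasis]
  rw [Module.Basis.span_eq]
  exact mul_ne_zero Nat.card_pos.ne' (by simp)

theorem gramDet_eq_liftBasis (c : L) (B : N →ₗ[ℤ] N →ₗ[ℤ] L) :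
    gramDet c B = (Matrix.of fun i j => c * B (liftBasis N i) (liftBasis N j)).det := by
  rw [gramDet]
  simp only [← mkQ_liftBasis]
  rfl

end Lattice

/-! ### Determinants of direct sums. -/

/-- The determinant of a block diagonal matrix with blocks of varying sizes. -/
theorem det_blockDiagonal' {ι R : Type*} [Fintype ι] [DecidableEq ι] [CommRing R] {κ : ι → Type*}
    [∀ i, Fintype (κ i)] [∀ i, DecidableEq (κ i)] (A : ∀ i, Matrix (κ i) (κ i) R) :
    (Matrix.blockDiagonal' A).det = ∏ i, (A i).det := by
  classical
  -- Any linear order will do: it only serves to regard the matrix as block triangular.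
  let _ : LinearOrder ι := linearOrderOfSTO WellOrderingRel
  rw [(Matrix.blockTriangular_blockDiagonal' A).det_fintype]
  refine Finset.prod_congr rfl fun i _ => ?_
  rw [← Matrix.det_reindex_self (Equiv.sigmaSubtype i)]
  congr 1
  ext k l
  exact Matrix.blockDiagonal'_apply_eq A i k l

/-- The determinant of a direct product of endomorphisms. -/
theorem det_piMap {ι R : Type*} [Fintype ι] [CommRing R] {V : ι → Type*}
    [∀ i, AddCommGroup (V i)] [∀ i, Module R (V i)] [∀ i, Module.Free R (V i)]
    [∀ i, Module.Finite R (V i)] (f : ∀ i, V i →ₗ[R] V i) :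
    LinearMap.det (LinearMap.pi fun i => (f i).comp (LinearMap.proj i)) =
      ∏ i, LinearMap.det (f i) := by
  classical
  let b := fun i => Module.Free.chooseBasis R (V i)
  rw [← LinearMap.det_toMatrix (Pi.basis b)]
  simp_rw [← LinearMap.det_toMatrix (b _)]
  rw [← det_blockDiagonal']
  congr 1
  ext ⟨i, k⟩ ⟨j, l⟩
  rw [LinearMap.toMatrix_apply, Matrix.blockDiagonal'_apply, Pi.basis_apply, Pi.basis_repr]
  split_ifs with h
  · obtain rfl : i = j := h
    simp [LinearMap.toMatrix_apply]
  · simp [Pi.single_eq_of_ne h]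

/-! ### Fixed subspaces, permutation representations and Brauer relations. -/

section Brauer

variable {G : Type} [Group G] {L : Type v} [Field L] {W : Type*} [AddCommGroup W]
  [Module L W]

/-- The subspace of vectors fixed by a subgroup. -/
abbrev fixedSubspace (σ : Representation L G W) (H : Subgroup G) : Submodule L W :=
  Representation.invariants (σ.comp H.subtype : Representation L H W)

theorem mem_fixedSubspace {σ : Representation L G W} {H : Subgroup G} {w : W} :
    w ∈ fixedSubspace σ H ↔ ∀ h ∈ H, σ h w = w := by
  simp [fixedSubspace, Representation.mem_invariants]

/-- The restriction to the fixed subspace of an endomorphism of a representation. -/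
def restrictFixed (σ : Representation L G W) (φ : W →ₗ[L] W)
    (hφ : ∀ g w, φ (σ g w) = σ g (φ w)) (H : Subgroup G) :
    fixedSubspace σ H →ₗ[L] fixedSubspace σ H :=
  φ.restrict fun w hw => mem_fixedSubspace.2 fun h hh => by
    rw [← hφ, mem_fixedSubspace.1 hw h hh]

variable [Module ℚ W] [SMulCommClass ℚ L W]

/-- The space of equivariant maps from a permutation representation. -/
def permHom (σ : Representation L G W) (m : Subgroup G → ℕ) :
    Submodule L ((⨁ p : (Σ H : Subgroup G, Fin (m H)), MonoidAlgebra ℚ (G ⧸ p.1)) →ₗ[ℚ] W) where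
  carrier := {u | ∀ g x, u (permRep m g x) = σ g (u x)}
  add_mem' hu hv g x := by simp [hu g x, hv g x]
  zero_mem' g x := by simp
  smul_mem' c u hu g x := by simp [hu g x]

/-- The distinguished generators of a permutation representation. -/
def permGen (m : Subgroup G → ℕ) (p : Σ H : Subgroup G, Fin (m H)) :
    ⨁ p : (Σ H : Subgroup G, Fin (m H)), MonoidAlgebra ℚ (G ⧸ p.1) :=
  open scoped Classical in
  DirectSum.lof ℚ _ (fun p : (Σ H : Subgroup G, Fin (m H)) => MonoidAlgebra ℚ (G ⧸ p.1)) p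
    (MonoidAlgebra.single ((1 : G) : G ⧸ p.1) 1)

open scoped Classical in
theorem permRep_permGen (m : Subgroup G → ℕ) (p : Σ H : Subgroup G, Fin (m H)) (g : G) :
    permRep m g (permGen m p) =
      DirectSum.lof ℚ _ (fun p : (Σ H : Subgroup G, Fin (m H)) => MonoidAlgebra ℚ (G ⧸ p.1)) p
        (MonoidAlgebra.single (g : G ⧸ p.1) 1) := by
  simp [permRep, permGen]

/-- Frobenius reciprocity: evaluation at the distinguished generators. -/
def permHomEval (σ : Representation L G W) (m : Subgroup G → ℕ) :
    permHom σ m →ₗ[L] ∀ p : (Σ H : Subgroup G, Fin (m H)), fixedSubspace σ p.1 where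
  toFun u p := ⟨u.1 (permGen m p), mem_fixedSubspace.2 fun h hh => by
    classical
    rw [← u.2 h, permRep_permGen, permGen]
    congr 3
    exact QuotientGroup.eq.2 (by simpa using hh)⟩
  map_add' u v := rfl
  map_smul' c u := rfl

/-- The translates of the generators span, which gives injectivity. Conversely, an `H`-fixed vector
`z` determines the equivariant map that sends the coset `gH` to `σ g z`. -/
theorem permHomEval_bijective (σ : Representation L G W) (m : Subgroup G → ℕ) :
    Function.Bijective (permHomEval σ m) := by
  classical
  constructor
  · intro u u' h
    apply Subtype.ext
    refine DirectSum.linearMap_ext ℚ fun p => ?_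
    refine MonoidAlgebra.lhom_ext' fun x => LinearMap.ext_ring ?_
    induction x using QuotientGroup.induction_on with | H g => ?_
    have h1 : u.1 (permGen m p) = u'.1 (permGen m p) := congrArg Subtype.val (congrFun h p)
    have h2 := u.2 g (permGen m p)
    have h3 := u'.2 g (permGen m p)
    rw [permRep_permGen] at h2 h3
    exact h2.trans (h1 ▸ h3.symm)
  · intro z
    let c : ∀ p : (Σ H : Subgroup G, Fin (m H)), MonoidAlgebra ℚ (G ⧸ p.1) →ₗ[ℚ] W := fun p =>
      (Finsupp.lsum ℚ fun x : G ⧸ p.1 => LinearMap.toSpanSingleton ℚ W (σ x.out (z p).1)) ∘ₗ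
        (MonoidAlgebra.coeffLinearEquiv ℚ).toLinearMap
    have hc : ∀ p (g : G), c p (MonoidAlgebra.single (g : G ⧸ p.1) 1) = σ g (z p).1 := fun p g => by
      obtain ⟨h, hh⟩ := QuotientGroup.mk_out_eq_mul p.1 g
      -- The chosen representative of a coset differs from `g` by an element of the subgroup, which
      -- fixes `z p`.
      simp only [c, LinearMap.comp_apply]
      have h1 := mem_fixedSubspace.1 (z p).2 h h.2
      simp [hh, h1]
    let u := DirectSum.toModule ℚ _ W c
    have hu : ∀ p x, u (DirectSum.lof ℚ _
        (fun p : (Σ H : Subgroup G, Fin (m H)) => MonoidAlgebra ℚ (G ⧸ p.1)) p x) = c p x :=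
      fun p x => DirectSum.toModule_lof (R := ℚ) (φ := c) p x
    have hsmul : ∀ (g : G) (a : ℚ) (w : W), σ g (a • w) = a • σ g w := fun g a w =>
      map_rat_smul (σ g) a w
    refine ⟨⟨u, fun g x => ?_⟩, funext fun p => Subtype.ext ?_⟩
    · let s : W →ₗ[ℚ] W := { toFun := σ g, map_add' := map_add _, map_smul' := hsmul g }
      suffices u ∘ₗ permRep m g = s ∘ₗ u from LinearMap.congr_fun this x
      refine DirectSum.linearMap_ext ℚ fun p => ?_
      refine MonoidAlgebra.lhom_ext' fun x => LinearMap.ext_ring ?_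
      induction x using QuotientGroup.induction_on with | H k => ?_
      simp only [LinearMap.comp_apply, MonoidAlgebra.lsingle_apply]
      rw [hu, hc, ← permRep_permGen, ← Module.End.mul_apply, ← map_mul, permRep_permGen, hu, hc,
        map_mul]
      rfl
    · change u (permGen m p) = _
      rw [permGen, hu, hc, map_one]
      rfl

/-- Composition with an endomorphism, on equivariant maps from a permutation representation. -/
def permHomComp (σ : Representation L G W) (φ : W →ₗ[L] W)
    (hφ : ∀ g w, φ (σ g w) = σ g (φ w)) (m : Subgroup G → ℕ) :
    permHom σ m →ₗ[L] permHom σ m where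
  toFun u := ⟨(AddMonoidHom.toRatLinearMap φ.toAddMonoidHom) ∘ₗ u.1, fun g x => by
    simp only [LinearMap.comp_apply, u.2 g x]
    exact hφ g _⟩
  map_add' u v := Subtype.ext (LinearMap.ext fun x => map_add φ _ _)
  map_smul' c u := Subtype.ext (LinearMap.ext fun x => map_smul φ _ _)

/-- Evaluation at the generators turns composition with `φ` into the diagonal action of `φ` on a
product of fixed subspaces, where `H` occurs `m H` times. -/
theorem det_permHomComp [Finite G] [Module.Finite L W] (σ : Representation L G W) (φ : W →ₗ[L] W)
    (hφ : ∀ g w, φ (σ g w) = σ g (φ w)) (m : Subgroup G → ℕ) [Fintype (Subgroup G)] :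
    LinearMap.det (permHomComp σ φ hφ m) =
      ∏ H : Subgroup G, LinearMap.det (restrictFixed σ φ hφ H) ^ m H := by
  let e := LinearEquiv.ofBijective _ (permHomEval_bijective σ m)
  rw [← LinearMap.det_conj _ e]
  have : (e.toLinearMap ∘ₗ permHomComp σ φ hφ m ∘ₗ e.symm.toLinearMap) =
      LinearMap.pi fun p : (Σ H : Subgroup G, Fin (m H)) =>
        (restrictFixed σ φ hφ p.1).comp (LinearMap.proj p) := by
    refine LinearMap.ext fun z => ?_
    obtain ⟨u, rfl⟩ := e.surjective z
    simp only [LinearMap.comp_apply, LinearEquiv.coe_coe, e.symm_apply_apply]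
    rfl
  rw [this, det_piMap, Fintype.prod_sigma]
  refine Finset.prod_congr rfl fun H _ => ?_
  exact (Finset.prod_const (LinearMap.det (restrictFixed σ φ hφ H))).trans
    (by rw [Finset.card_univ, Fintype.card_fin])

/-- For a Brauer relation, the alternating product of the determinants of an endomorphism of a
representation on the fixed subspaces is trivial. -/
theorem IsBrauerRelation.prod_det_eq [Finite G] [Module.Finite L W] {Θ : Subgroup G →₀ ℤ}
    (hΘ : IsBrauerRelation Θ) (σ : Representation L G W) (φ : W →ₗ[L] W)
    (hφ : ∀ g w, φ (σ g w) = σ g (φ w)) [Fintype (Subgroup G)] :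
    ∏ H : Subgroup G, LinearMap.det (restrictFixed σ φ hφ H) ^ (Θ H).toNat =
      ∏ H : Subgroup G, LinearMap.det (restrictFixed σ φ hφ H) ^ (-Θ H).toNat := by
  obtain ⟨T⟩ := hΘ
  rw [← det_permHomComp, ← det_permHomComp]
  have hT : ∀ g x, T (permRep _ g x) = permRep _ g (T x) := fun g x =>
    Representation.IntertwiningMap.isIntertwining _ _ T.toIntertwiningMap g x
  have hT' : ∀ g x, T.toLinearEquiv.symm (permRep _ g x) =
      permRep _ g (T.toLinearEquiv.symm x) := fun g x => by
    rw [LinearEquiv.symm_apply_eq]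
    refine Eq.trans ?_ (hT g _).symm
    congr 1
    exact (T.toLinearEquiv.apply_symm_apply x).symm
  -- Precomposition with the inverse of `T` commutes with postcomposition with `φ`, so `e`
  -- conjugates one action of `φ` into the other.
  let e : permHom σ (fun H => (Θ H).toNat) ≃ₗ[L] permHom σ (fun H => (-Θ H).toNat) :=
    { toFun := fun u => ⟨u.1 ∘ₗ T.toLinearEquiv.symm.toLinearMap, fun g x => by
        simp only [LinearMap.comp_apply, LinearEquiv.coe_coe, hT', u.2 g]⟩
      invFun := fun u => ⟨u.1 ∘ₗ T.toLinearEquiv.toLinearMap, fun g x => by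
        simp only [LinearMap.comp_apply]
        refine Eq.trans ?_ (u.2 g _)
        exact congrArg u.1 (hT g x)⟩
      map_add' := fun u v => rfl
      map_smul' := fun c u => rfl
      left_inv := fun u => Subtype.ext (LinearMap.ext fun x =>
        congrArg u.1 (T.toLinearEquiv.symm_apply_apply x))
      right_inv := fun u => Subtype.ext (LinearMap.ext fun x =>
        congrArg u.1 (T.toLinearEquiv.apply_symm_apply x)) }
  rw [← LinearMap.det_conj _ e]
  congr 1
  refine LinearMap.ext fun z => ?_
  obtain ⟨u, rfl⟩ := e.surjective z
  simp only [LinearMap.comp_apply, LinearEquiv.coe_coe, e.symm_apply_apply]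
  rfl

end Brauer

/-! ### Linear forms with values in a field of characteristic zero. -/

section Forms

variable {N : Type w} [AddCommGroup N] {L : Type v} [Field L] [CharZero L] [Module.Finite ℤ N]

omit [Module.Finite ℤ N] in
theorem form_torsion (w : N →ₗ[ℤ] L) {t : N} (ht : t ∈ Submodule.torsion ℤ N) : w t = 0 := by
  obtain ⟨a, ha⟩ := (Submodule.mem_torsion_iff t).1 ht
  have h : (a : ℤ) • w t = 0 := by
    rw [← map_smul, show ((a : ℤ) • t : N) = 0 from ha, map_zero]
  exact (smul_eq_zero.1 h).resolve_left (nonZeroDivisors.coe_ne_zero a)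

variable (N) in
/-- The coordinates modulo torsion with respect to `liftBasis`. -/
def liftCoord (i : Fin (Module.finrank ℤ (N ⧸ Submodule.torsion ℤ N))) :
    N →ₗ[ℤ] ℤ :=
  (Module.finBasis ℤ (N ⧸ Submodule.torsion ℤ N)).coord i ∘ₗ (Submodule.torsion ℤ N).mkQ

theorem liftCoord_liftBasis (i j) : liftCoord N i (liftBasis N j) = if j = i then 1 else 0 := by
  simp only [liftCoord, LinearMap.comp_apply, mkQ_liftBasis, Module.Basis.coord_apply,
    Module.Basis.repr_self, Finsupp.single_apply]

/-- Forms kill torsion, so they see only the coordinates modulo torsion. -/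
theorem form_eq_sum (w : N →ₗ[ℤ] L) (x : N) :
    w x = ∑ i, (liftCoord N i x : L) * w (liftBasis N i) := by
  have h : x - ∑ i, liftCoord N i x • liftBasis N i ∈ Submodule.torsion ℤ N := by
    rw [← Submodule.Quotient.mk_eq_zero, ← Submodule.mkQ_apply, map_sub, map_sum, sub_eq_zero]
    simp only [map_smul, mkQ_liftBasis]
    exact ((Module.finBasis ℤ (N ⧸ Submodule.torsion ℤ N)).sum_repr _).symm
  have h1 := form_torsion w h
  rw [map_sub, map_sum, sub_eq_zero] at h1
  simpa using h1

theorem form_ext {w w' : N →ₗ[ℤ] L} (h : ∀ i, w (liftBasis N i) = w' (liftBasis N i)) :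
    w = w' := by
  ext x
  rw [form_eq_sum w, form_eq_sum w']
  simp only [h]

instance finite_forms : Module.Finite L (N →ₗ[ℤ] L) := by
  let ev : (N →ₗ[ℤ] L) →ₗ[L] (Fin (Module.finrank ℤ (N ⧸ Submodule.torsion ℤ N)) → L) :=
    LinearMap.pi fun i =>
      { toFun := fun w => w (liftBasis N i), map_add' := fun _ _ => rfl,
        map_smul' := fun _ _ => rfl }
  exact Module.Finite.of_injective ev fun w w' h => form_ext fun i => congrFun h i

theorem gramDet_eq_pow_mul (c : L) (B : N →ₗ[ℤ] N →ₗ[ℤ] L) :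
    gramDet c B = c ^ Module.finrank ℤ (N ⧸ Submodule.torsion ℤ N) * gramDet 1 B := by
  have h : (Matrix.of fun i j => c * B (liftBasis N i) (liftBasis N j)) =
      c • (Matrix.of fun i j => (1 : L) * B (liftBasis N i) (liftBasis N j)) := by
    ext; simp
  rw [gramDet_eq_liftBasis, gramDet_eq_liftBasis, h, Matrix.det_smul, Fintype.card_fin]

end Forms

/-! ### Comparison of two pairings on the fixed submodules. -/

section Independence

variable {G : Type} [Group G] {M : Type w} [AddCommGroup M] [Module.Finite ℤ M]
  {ρ : Representation ℤ G M} {L : Type v} [Field L] [CharZero L]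

omit [Module.Finite ℤ M] in
theorem mem_fixed {H : Subgroup G} {x : M} : x ∈ fixed ρ H ↔ ∀ h ∈ H, ρ h x = x := by
  simp [fixed, Representation.mem_invariants]

variable (ρ L) in
/-- The representation on the linear forms on `M` with values in `L`. -/
def formRep : Representation L G (M →ₗ[ℤ] L) where
  toFun g := { toFun := fun w => w ∘ₗ ρ g⁻¹, map_add' := fun _ _ => rfl,
               map_smul' := fun _ _ => rfl }
  map_one' := by ext; simp
  map_mul' g h := by ext; simp

omit [Module.Finite ℤ M] [CharZero L] in
theorem formRep_apply (g : G) (w : M →ₗ[ℤ] L) (x : M) : formRep ρ L g w x = w (ρ g⁻¹ x) := rfl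

theorem Pairing.formRep_eq (B : Pairing ρ L) (g : G) (x : M) :
    formRep ρ L g (B.toBilin x) = B.toBilin (ρ g x) := by
  ext y
  rw [formRep_apply, ← B.invariant g]
  simp

theorem Pairing.mem_fixedSubspace (B : Pairing ρ L) {H : Subgroup G} {x : M}
    (hx : x ∈ fixed ρ H) : B.toBilin x ∈ fixedSubspace (formRep ρ L) H :=
  RegulatorConstant.mem_fixedSubspace.2 fun h hh => by rw [B.formRep_eq, mem_fixed.1 hx h hh]

/-- The Gram matrix of a pairing. -/
def Pairing.gram (B : Pairing ρ L) : Matrix (Fin (Module.finrank ℤ (M ⧸ Submodule.torsion ℤ M)))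
    (Fin (Module.finrank ℤ (M ⧸ Submodule.torsion ℤ M))) L :=
  Matrix.of fun i j => B.toBilin (liftBasis M i) (liftBasis M j)

theorem Pairing.isUnit_det_gram (B : Pairing ρ L) : IsUnit B.gram.det := by
  have h := B.nondegenerate
  rw [gramDet_eq_liftBasis] at h
  simpa [gram] using h

/-- The coefficients of a linear form with respect to the forms `B (b i)`. -/
def Pairing.coeff (B : Pairing ρ L)
    (k : Fin (Module.finrank ℤ (M ⧸ Submodule.torsion ℤ M))) : (M →ₗ[ℤ] L) →ₗ[L] L where
  toFun w := ∑ i, w (liftBasis M i) * B.gram⁻¹ i k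
  map_add' w w' := by simp [add_mul, Finset.sum_add_distrib]
  map_smul' c w := by simp [Finset.mul_sum, mul_assoc]

/-- Non-degeneracy makes the forms `B (b i)` a basis of the space of all forms; the coefficients
come from the inverse Gram matrix. -/
theorem Pairing.sum_coeff_smul (B : Pairing ρ L) (w : M →ₗ[ℤ] L) :
    ∑ k, B.coeff k w • B.toBilin (liftBasis M k) = w := by
  refine form_ext fun l => ?_
  let a : _ → L := fun i => w (liftBasis M i)
  have h : Matrix.vecMul (Matrix.vecMul a B.gram⁻¹) B.gram = a := by
    rw [Matrix.vecMul_vecMul, Matrix.nonsing_inv_mul _ B.isUnit_det_gram, Matrix.vecMul_one]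
  simpa [Matrix.vecMul, dotProduct, a, coeff, gram, LinearMap.sum_apply] using congrFun h l

theorem Pairing.coeff_apply_liftBasis (B : Pairing ρ L) (k l) :
    B.coeff k (B.toBilin (liftBasis M l)) = if l = k then 1 else 0 := by
  have h := Matrix.mul_nonsing_inv _ B.isUnit_det_gram
  simpa [Matrix.mul_apply, gram, coeff, Matrix.one_apply] using congrFun (congrFun h l) k

theorem Pairing.coeff_apply (B : Pairing ρ L) (k) (x : M) :
    B.coeff k (B.toBilin x) = (liftCoord M k x : L) := by
  let w : M →ₗ[ℤ] L := (B.coeff k).toAddMonoidHom.toIntLinearMap ∘ₗ B.toBilin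
  have h : w = (Int.castAddHom L).toIntLinearMap ∘ₗ liftCoord M k := by
    refine form_ext fun l => ?_
    have h1 : w (liftBasis M l) = _ := B.coeff_apply_liftBasis k l
    rw [h1]
    simp only [LinearMap.comp_apply, liftCoord_liftBasis]
    split_ifs <;> simp
  exact LinearMap.congr_fun h x

/-- The endomorphism of the space of linear forms comparing two pairings. -/
def Pairing.compare (B₀ B : Pairing ρ L) : (M →ₗ[ℤ] L) →ₗ[L] (M →ₗ[ℤ] L) :=
  ∑ k, (B₀.coeff k).smulRight (B.toBilin (liftBasis M k))

/-- By construction this holds on the lifted basis; it extends to all of `M`, torsion included, by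
expanding in coordinates modulo torsion. -/
theorem Pairing.compare_apply (B₀ B : Pairing ρ L) (x : M) :
    B₀.compare B (B₀.toBilin x) = B.toBilin x := by
  ext y
  have h := form_eq_sum (B.toBilin.flip y) x
  simp only [LinearMap.flip_apply] at h
  rw [h]
  simp [compare, LinearMap.sum_apply, coeff_apply]

theorem Pairing.compare_comm (B₀ B : Pairing ρ L) (g : G) (w : M →ₗ[ℤ] L) :
    B₀.compare B (formRep ρ L g w) = formRep ρ L g (B₀.compare B w) := by
  rw [← B₀.sum_coeff_smul w]
  simp only [map_sum, map_smul, B₀.formRep_eq, B.formRep_eq, compare_apply]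

variable (ρ L) in
/-- The values of an `H`-invariant linear form on a basis of `M^H` modulo torsion. -/
def evalFixed (H : Subgroup G) : fixedSubspace (formRep ρ L) H →ₗ[L]
    (Fin (Module.finrank ℤ (fixed ρ H ⧸ Submodule.torsion ℤ (fixed ρ H))) → L) where
  toFun w i := w.1 (liftBasis (fixed ρ H) i)
  map_add' _ _ := rfl
  map_smul' _ _ := rfl

variable (ρ) in
/-- The sum over the elements of a subgroup. -/
def sumMap [Finite G] (H : Subgroup G) : M →ₗ[ℤ] fixed ρ H :=
  have := Fintype.ofFinite H
  (∑ h : H, ρ h).codRestrict (fixed ρ H) fun x => mem_fixed.2 fun k hk => by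
    simp only [LinearMap.sum_apply, map_sum, ← Module.End.mul_apply, ← map_mul]
    exact Fintype.sum_equiv (Equiv.mulLeft (⟨k, hk⟩ : H)) _ _ fun h => rfl

omit [Module.Finite ℤ M] [CharZero L] in
theorem form_sumMap [Finite G] {H : Subgroup G} {w : M →ₗ[ℤ] L}
    (hw : w ∈ fixedSubspace (formRep ρ L) H) (x : M) :
    w (sumMap ρ H x) = Nat.card H * w x := by
  have := Fintype.ofFinite H
  have h1 : ∀ h : H, w (ρ h x) = w x := fun h => by
    have := LinearMap.congr_fun (mem_fixedSubspace.1 hw _ (inv_mem h.2)) x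
    rwa [formRep_apply, inv_inv] at this
  have h2 : ((sumMap ρ H x : fixed ρ H) : M) = ∑ h : H, ρ h x := by
    simp [sumMap, LinearMap.sum_apply]
    congr!
  rw [h2, map_sum]
  simp [h1]

omit [Module.Finite ℤ M] in
theorem sumMap_apply [Finite G] {H : Subgroup G} {x : M} (hx : x ∈ fixed ρ H) :
    ((sumMap ρ H x : fixed ρ H) : M) = Nat.card H • x := by
  have := Fintype.ofFinite H
  have h1 : ∀ h : H, ρ h x = x := fun h => mem_fixed.1 hx h h.2
  simp [sumMap, LinearMap.sum_apply, h1]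
  congr!

/-- An `H`-invariant form satisfies `w x = |H|⁻¹ w (∑ h x)`, so it is determined by its restriction
to `M^H`; the same formula extends any form on `M^H` to an invariant one. -/
theorem evalFixed_bijective [Finite G] (H : Subgroup G) :
    Function.Bijective (evalFixed ρ L H) := by
  have hH : (Nat.card H : L) ≠ 0 := Nat.cast_ne_zero.2 Nat.card_pos.ne'
  constructor
  · rw [injective_iff_map_eq_zero]
    intro w hw
    have h0 : w.1 ∘ₗ (fixed ρ H).subtype = 0 := form_ext fun i => congrFun hw i
    ext x
    have h := form_sumMap w.2 x
    have h1 : w.1 (sumMap ρ H x) = 0 := LinearMap.congr_fun h0 (sumMap ρ H x)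
    rw [h1] at h
    exact (mul_eq_zero.1 h.symm).resolve_left hH
  · intro a
    let l : fixed ρ H →ₗ[ℤ] L :=
      ∑ i, (LinearMap.toSpanSingleton ℤ L (a i) : ℤ →ₗ[ℤ] L) ∘ₗ liftCoord (fixed ρ H) i
    have hl : ∀ i, l (liftBasis (fixed ρ H) i) = a i := fun i => by
      simp [l, LinearMap.sum_apply, liftCoord_liftBasis]
    let w : M →ₗ[ℤ] L := (Nat.card H : L)⁻¹ • (l ∘ₗ sumMap ρ H)
    refine ⟨⟨w, mem_fixedSubspace.2 fun h hh => ?_⟩, funext fun i => ?_⟩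
    · ext x
      have : sumMap ρ H (ρ h⁻¹ x) = sumMap ρ H x := by
        apply Subtype.ext
        simp only [sumMap, LinearMap.codRestrict_apply, LinearMap.sum_apply,
          ← Module.End.mul_apply, ← map_mul]
        let _ := Fintype.ofFinite H
        exact Fintype.sum_equiv (Equiv.mulRight (⟨h, hh⟩ : H)⁻¹)
          (fun k : H => ρ (k * h⁻¹) x) (fun k : H => ρ k x) fun k => rfl
      simp [formRep_apply, w, this]
    · have : sumMap ρ H (liftBasis (fixed ρ H) i) = Nat.card H • liftBasis (fixed ρ H) i :=
        Subtype.ext (sumMap_apply (liftBasis (fixed ρ H) i).2)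
      change w (liftBasis (fixed ρ H) i) = a i
      simp only [w, LinearMap.smul_apply, LinearMap.comp_apply, this, map_nsmul, hl, nsmul_eq_mul,
        smul_eq_mul]
      rw [inv_mul_cancel_left₀ hH]

/-- The restriction of a pairing to the fixed submodule of `H`. -/
abbrev Pairing.onFixed (B : Pairing ρ L) (H : Subgroup G) :
    fixed ρ H →ₗ[ℤ] fixed ρ H →ₗ[ℤ] L :=
  B.toBilin.domRestrict₁₂ (fixed ρ H) (fixed ρ H)

/-- In the coordinates given by evaluation, the columns of the transposed Gram matrices are the
forms `B₀ (b j)` and `B (b j)`, and the comparison map carries the former to the latter. -/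
theorem Pairing.gramDet_onFixed [Finite G] (B₀ B : Pairing ρ L) (H : Subgroup G) :
    gramDet 1 (B.onFixed H) =
      LinearMap.det (restrictFixed (formRep ρ L) (B₀.compare B) (B₀.compare_comm B) H) *
        gramDet 1 (B₀.onFixed H) := by
  let e := LinearEquiv.ofBijective _ (evalFixed_bijective (ρ := ρ) (L := L) H)
  let φ := restrictFixed (formRep ρ L) (B₀.compare B) (B₀.compare_comm B) H
  rw [← LinearMap.det_conj _ e, gramDet_eq_liftBasis, gramDet_eq_liftBasis,
    ← LinearMap.det_toMatrix', ← Matrix.det_transpose, ← Matrix.det_transpose (Matrix.of _),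
    ← Matrix.det_mul]
  congr 1
  ext i j
  let x : fixed ρ H := liftBasis (fixed ρ H) j
  let w : fixedSubspace (formRep ρ L) H := ⟨B₀.toBilin x, B₀.mem_fixedSubspace x.2⟩
  have h : (LinearMap.toMatrix' (e.toLinearMap ∘ₗ φ ∘ₗ e.symm.toLinearMap)).mulVec (e w) = e (φ w) := by
    rw [LinearMap.toMatrix'_mulVec]
    simp
  have h1 : e (φ w) i = B.toBilin x (liftBasis (fixed ρ H) i) :=
    LinearMap.congr_fun (B₀.compare_apply B x) _
  have h2 := congrFun h i
  rw [h1] at h2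
  simp only [Matrix.transpose_apply, Matrix.of_apply, one_mul, Matrix.mul_apply]
  exact h2.symm

theorem Pairing.gramDet_onFixed_ne_zero [Finite G] (B : Pairing ρ L) (H : Subgroup G) :
    gramDet 1 (B.onFixed H) ≠ 0 := by
  have hH : (Nat.card H : L) ≠ 0 := Nat.cast_ne_zero.2 Nat.card_pos.ne'
  rw [gramDet_eq_liftBasis, ← isUnit_iff_ne_zero, ← Matrix.isUnit_iff_isUnit_det,
    ← Matrix.vecMul_surjective_iff_isUnit]
  intro a
  obtain ⟨w, rfl⟩ := (evalFixed_bijective (ρ := ρ) (L := L) H).2 a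
  let b := liftBasis (fixed ρ H)
  -- Write `w` as a combination of the forms `B (m k)`, replace each `m k` by its average over `H`,
  -- which does not change the values on `M^H`, and expand the averages in the basis of `M^H`.
  refine ⟨fun i => ∑ k, (Nat.card H : L)⁻¹ * (B.coeff k w.1 *
    (liftCoord (fixed ρ H) i (sumMap ρ H (liftBasis M k)) : L)), funext fun j => ?_⟩
  have h1 : ∀ k, ∑ i, (liftCoord (fixed ρ H) i (sumMap ρ H (liftBasis M k)) : L) *
      B.toBilin (b i) (b j) = Nat.card H * B.toBilin (liftBasis M k) (b j) := fun k => by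
    have h2 := form_eq_sum ((B.onFixed H).flip (b j)) (sumMap ρ H (liftBasis M k))
    refine h2.symm.trans ?_
    have h3 : B.toBilin.flip (b j) ∈ fixedSubspace (formRep ρ L) H := by
      refine RegulatorConstant.mem_fixedSubspace.2 fun h hh => ?_
      ext y
      have := B.invariant h (ρ h⁻¹ y) (b j)
      rw [mem_fixed.1 (b j).2 h hh] at this
      rw [formRep_apply, LinearMap.flip_apply, LinearMap.flip_apply, ← this]
      simp
    exact form_sumMap h3 _
  have h4 := LinearMap.congr_fun (B.sum_coeff_smul w.1) (b j)
  change _ = w.1 (b j)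
  rw [← h4]
  simp only [Matrix.vecMul, dotProduct, Matrix.of_apply, one_mul, LinearMap.sum_apply,
    LinearMap.smul_apply, smul_eq_mul, Finset.sum_mul]
  rw [Finset.sum_comm]
  refine Finset.sum_congr rfl fun k _ => ?_
  have h5 := congrArg (fun t => (Nat.card H : L)⁻¹ * (B.coeff k w.1 * t)) (h1 k)
  simp only [Finset.mul_sum] at h5
  refine Eq.trans (Finset.sum_congr rfl fun i _ => ?_) (h5.trans ?_)
  · change _ * B.toBilin (b i) (b j) = _
    ring
  · field_simp

end Independence

/-! ### Independence of the pairing and of the field. -/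

section Independence

variable {G : Type} [Group G] {M : Type w} [AddCommGroup M] [Module.Finite ℤ M]
  {ρ : Representation ℤ G M} {L : Type v} [Field L] [CharZero L]

/-- The factor of the regulator constant belonging to a subgroup `H`. -/
def Pairing.factor (B : Pairing ρ L) (H : Subgroup G) : L :=
  1 / (Nat.card ↥(Submodule.torsion ℤ M ⊓ fixed ρ H) : L) ^ 2 *
    gramDet (1 / (Nat.card H : L)) (B.onFixed H)

theorem regConstOf_eq_prod [Fintype (Subgroup G)] (Θ : Subgroup G →₀ ℤ) (B : Pairing ρ L) :
    regConstOf Θ ρ B = ∏ H, B.factor H ^ Θ H :=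
  Finsupp.prod_fintype _ _ fun _ => zpow_zero _

instance finite_torsion_inf (H : Subgroup G) :
    Finite ↥(Submodule.torsion ℤ M ⊓ fixed ρ H) :=
  Finite.of_injective _ (Submodule.inclusion_injective inf_le_left)

theorem Pairing.factor_ne_zero [Finite G] (B : Pairing ρ L) (H : Subgroup G) :
    B.factor H ≠ 0 := by
  rw [factor, gramDet_eq_pow_mul]
  have h1 : (Nat.card H : L) ≠ 0 := Nat.cast_ne_zero.2 Nat.card_pos.ne'
  have h2 : (Nat.card ↥(Submodule.torsion ℤ M ⊓ fixed ρ H) : L) ≠ 0 :=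
    Nat.cast_ne_zero.2 Nat.card_pos.ne'
  exact mul_ne_zero (one_div_ne_zero (pow_ne_zero _ h2))
    (mul_ne_zero (pow_ne_zero _ (one_div_ne_zero h1)) (B.gramDet_onFixed_ne_zero H))

theorem regConstOf_ne_zero [Finite G] (Θ : Subgroup G →₀ ℤ) (B : Pairing ρ L) :
    regConstOf Θ ρ B ≠ 0 :=
  Finset.prod_ne_zero_iff.2 fun H _ => zpow_ne_zero _ (B.factor_ne_zero H)

theorem Pairing.factor_eq [Finite G] (B₀ B : Pairing ρ L) (H : Subgroup G) :
    B.factor H =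
      LinearMap.det (restrictFixed (formRep ρ L) (B₀.compare B) (B₀.compare_comm B) H) *
        B₀.factor H := by
  rw [factor, factor, gramDet_eq_pow_mul, B₀.gramDet_onFixed B,
    gramDet_eq_pow_mul (1 / (Nat.card H : L)) (B₀.onFixed H)]
  ring

/-- The regulator constant of a Brauer relation does not depend on the pairing. -/
theorem IsBrauerRelation.regConstOf_eq [Finite G] {Θ : Subgroup G →₀ ℤ} (hΘ : IsBrauerRelation Θ)
    (B B₀ : Pairing ρ L) : regConstOf Θ ρ B = regConstOf Θ ρ B₀ := by
  have := Fintype.ofFinite (Subgroup G)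
  have hd : ∀ H, LinearMap.det (restrictFixed (formRep ρ L) (B₀.compare B)
      (B₀.compare_comm B) H) ≠ 0 := fun H h =>
    B.factor_ne_zero H (by rw [B₀.factor_eq B, h, zero_mul])
  have h := hΘ.prod_det_eq (formRep ρ L) (B₀.compare B) (B₀.compare_comm B)
  rw [regConstOf_eq_prod, regConstOf_eq_prod]
  simp only [B₀.factor_eq B, mul_zpow, Finset.prod_mul_distrib]
  have h1 : ∀ H, LinearMap.det (restrictFixed (formRep ρ L) (B₀.compare B)
      (B₀.compare_comm B) H) ^ Θ H = LinearMap.det (restrictFixed (formRep ρ L) (B₀.compare B)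
      (B₀.compare_comm B) H) ^ (Θ H).toNat / LinearMap.det (restrictFixed (formRep ρ L)
      (B₀.compare B) (B₀.compare_comm B) H) ^ (-Θ H).toNat := fun H => by
    rw [← zpow_natCast, ← zpow_natCast, ← zpow_sub₀ (hd H), Int.toNat_sub_toNat_neg]
  simp only [h1, Finset.prod_div_distrib]
  rw [h, div_self (Finset.prod_ne_zero_iff.2 fun H _ => pow_ne_zero _ (hd H)), one_mul]

theorem gramDet_ratCast {N : Type w} [AddCommGroup N] [Module.Finite ℤ N] (c : ℚ)
    (B : N →ₗ[ℤ] N →ₗ[ℤ] ℚ) (B' : N →ₗ[ℤ] N →ₗ[ℤ] L) (h : ∀ x y, B' x y = (B x y : L)) :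
    gramDet (c : L) B' = ((gramDet c B : ℚ) : L) := by
  rw [gramDet_eq_liftBasis, gramDet_eq_liftBasis]
  refine Eq.trans ?_ (RingHom.map_det (Rat.castHom L) _).symm
  congr 1
  ext i j
  simp [h]

variable (L) in
/-- A rational pairing with its values considered in an extension of `ℚ`. -/
def Pairing.ofRat (B : Pairing ρ ℚ) : Pairing ρ L where
  toBilin := B.toBilin.compr₂ (Rat.castHom L).toAddMonoidHom.toIntLinearMap
  invariant g x y := congrArg (Rat.cast : ℚ → L) (B.invariant g x y)
  nondegenerate := by
    have h := gramDet_ratCast (L := L) 1 B.toBilin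
      (B.toBilin.compr₂ (Rat.castHom L).toAddMonoidHom.toIntLinearMap) fun _ _ => rfl
    rw [Rat.cast_one] at h
    rw [h]
    exact Rat.cast_ne_zero.2 B.nondegenerate

theorem regConstOf_ofRat [Finite G] (Θ : Subgroup G →₀ ℤ) (B : Pairing ρ ℚ) :
    regConstOf Θ ρ (B.ofRat L) = ((regConstOf Θ ρ B : ℚ) : L) := by
  have := Fintype.ofFinite (Subgroup G)
  rw [regConstOf_eq_prod, regConstOf_eq_prod, Rat.cast_prod]
  refine Finset.prod_congr rfl fun H _ => ?_
  rw [Rat.cast_zpow, Pairing.factor, Pairing.factor, Rat.cast_mul,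
    ← gramDet_ratCast (L := L) _ (B.onFixed H) ((B.ofRat L).onFixed H) fun _ _ => rfl]
  push_cast
  rfl

/-- The rational pairing used to define `regConst` is extended to `L`, where it can be compared with
`B`. -/
theorem IsBrauerRelation.regConstOf_eq_regConst [Finite G] {Θ : Subgroup G →₀ ℤ}
    (hΘ : IsBrauerRelation Θ) (B : Pairing ρ L) : regConstOf Θ ρ B = (regConst Θ ρ : L) := by
  rw [hΘ.regConstOf_eq B ((nonempty_pairing ρ).some.ofRat L), regConstOf_ofRat]
  rfl

end Independence

/-! ### Gram determinants in exact sequences. -/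

section ExactLattice

theorem index_span_ne_zero {N : Type*} [AddCommGroup N] [Module.Finite ℤ N] {ι : Type*}
    [Fintype ι] {b : ι → N} (hb : LinearIndependent ℤ b)
    (hc : Fintype.card ι = Module.finrank ℤ (N ⧸ Submodule.torsion ℤ N)) :
    (Submodule.span ℤ (Set.range b)).toAddSubgroup.index ≠ 0 := by
  rw [index_span hb]
  refine mul_ne_zero Nat.card_pos.ne' (AddSubgroup.index_ne_zero_iff_finite.2 ?_)
  exact (Submodule.finiteQuotient_iff _).2
    ((finrank_span_eq_card (linearIndependent_mkQ_torsion hb)).trans hc)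

variable {A' A A'' : Type*} [AddCommGroup A'] [AddCommGroup A] [AddCommGroup A'']
  {L : Type v} [Field L] [CharZero L] {f : A' →ₗ[ℤ] A} {g : A →ₗ[ℤ] A''} {s : A'' →ₗ[ℤ] A} {n : ℕ}

/-- Applying `g` kills the first sum and multiplies the coefficients of the second by `n`. This
yields both the independence of the combined family and the intersection of its span with `f(A')`.
-/
theorem eq_of_sum_eq (hf : Function.Injective f) (hgf : ∀ x, g (f x) = 0) (hn : n ≠ 0)
    (hs : ∀ z, g (s z) = n • z) {ι κ : Type*} [Fintype ι] [Fintype κ] (b' : ι → A') {b'' : κ → A''}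
    (hb'' : LinearIndependent ℤ b'') {a : ι → ℤ} {c : κ → ℤ} {x : A'}
    (h : ∑ i, a i • f (b' i) + ∑ k, c k • s (b'' k) = f x) : c = 0 ∧ ∑ i, a i • b' i = x := by
  have h1 := congrArg g h
  simp only [map_add, map_sum, map_smul, hgf, hs, smul_zero, Finset.sum_const_zero, zero_add] at h1
  have h2 : ∑ k, (c k * n) • b'' k = 0 := by
    simpa only [mul_smul, natCast_zsmul] using h1
  have hc : c = 0 := funext fun k => (mul_eq_zero.1
    (Fintype.linearIndependent_iff.1 hb'' _ h2 k)).resolve_right (Int.natCast_ne_zero.2 hn)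
  refine ⟨hc, hf ?_⟩
  rw [← h, hc]
  simp

variable [Module.Finite ℤ A'] [Module.Finite ℤ A] [Module.Finite ℤ A'']

/-- Gram determinants in an exact sequence `0 → A' → A → A''` whose last map has image of finite
index, for compatible bilinear forms. -/
theorem gramDet_exact (hf : Function.Injective f) (hfg : Function.Exact f g) (hn : n ≠ 0)
    (hs : ∀ z, g (s z) = n • z) (c : L) {B' : A' →ₗ[ℤ] A' →ₗ[ℤ] L} {B : A →ₗ[ℤ] A →ₗ[ℤ] L}
    {B'' : A'' →ₗ[ℤ] A'' →ₗ[ℤ] L} (h11 : ∀ x y, B (f x) (f y) = B' x y)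
    (h12 : ∀ x z, B (f x) (s z) = 0) (h21 : ∀ z x, B (s z) (f x) = 0)
    (h22 : ∀ y z, B (s y) (s z) = B'' (g (s y)) (g (s z))) :
    g.toAddMonoidHom.range.index ≠ 0 ∧
    gramDet c B * ((Nat.card (Submodule.torsion ℤ A') : L) ^ 2 *
        (Nat.card (Submodule.torsion ℤ A'') : L) ^ 2) =
      gramDet c B' * gramDet c B'' * (Nat.card (Submodule.torsion ℤ A) : L) ^ 2 *
        (g.toAddMonoidHom.range.index : L) ^ 2 := by
  let b' := liftBasis A'
  let b'' := liftBasis A''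
  have hb'' := linearIndependent_liftBasis A''
  have hgf : ∀ x, g (f x) = 0 := fun x => (hfg _).2 ⟨x, rfl⟩
  let u := Sum.elim (fun i => f (b' i)) (fun k => s (b'' k))
  have hu : LinearIndependent ℤ u := by
    rw [Fintype.linearIndependent_iff]
    intro a ha
    rw [Fintype.sum_sum_type] at ha
    obtain ⟨h1, h2⟩ := eq_of_sum_eq (x := 0) hf hgf hn hs b' hb''
      (a := fun i => a (Sum.inl i)) (c := fun k => a (Sum.inr k)) (by rw [map_zero]; exact ha)
    rintro (i | k)
    · exact Fintype.linearIndependent_iff.1 (linearIndependent_liftBasis A') _ h2 i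
    · exact congrFun h1 k
  let u'' := fun k => g (s (b'' k))
  have hu'' : LinearIndependent ℤ u'' := by
    rw [Fintype.linearIndependent_iff]
    intro a ha
    have h : ∑ k, (a k * n) • b'' k = 0 := by
      simpa only [u'', hs, mul_smul, natCast_zsmul] using ha
    exact fun k => (mul_eq_zero.1
      (Fintype.linearIndependent_iff.1 hb'' _ h k)).resolve_right (Int.natCast_ne_zero.2 hn)
  let F := (Submodule.span ℤ (Set.range u)).toAddSubgroup
  let F' := (Submodule.span ℤ (Set.range b')).toAddSubgroup
  let F'' := (Submodule.span ℤ (Set.range u'')).toAddSubgroup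
  have hF' : F'.index ≠ 0 := index_span_liftBasis A'
  have hF'' : F''.index ≠ 0 := index_span_ne_zero hu'' (by simp)
  have hker : F.relIndex g.toAddMonoidHom.ker = F'.index := by
    have h1 : g.toAddMonoidHom.ker = f.toAddMonoidHom.range := by
      ext x
      exact hfg x
    have h2 : F' = F.comap f.toAddMonoidHom := by
      ext x
      change x ∈ Submodule.span ℤ (Set.range b') ↔ f x ∈ Submodule.span ℤ (Set.range u)
      rw [Submodule.mem_span_range_iff_exists_fun, Submodule.mem_span_range_iff_exists_fun]
      constructor
      · rintro ⟨a, rfl⟩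
        exact ⟨Sum.elim a 0, by simp [Fintype.sum_sum_type, u]⟩
      · rintro ⟨a, ha⟩
        rw [Fintype.sum_sum_type] at ha
        exact ⟨_, (eq_of_sum_eq hf hgf hn hs b' hb'' ha).2⟩
    rw [h1, h2, AddSubgroup.index_comap]
  have hmap : F.map g.toAddMonoidHom = F'' := by
    have h1 : (Submodule.span ℤ (Set.range u)).map g = Submodule.span ℤ (Set.range u'') := by
      rw [Submodule.map_span]
      apply le_antisymm
      · rw [Submodule.span_le]
        rintro _ ⟨_, ⟨i | k, rfl⟩, rfl⟩
        · simp [u, hgf]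
        · exact Submodule.subset_span ⟨k, rfl⟩
      · refine Submodule.span_mono ?_
        rintro _ ⟨k, rfl⟩
        exact ⟨_, ⟨Sum.inr k, rfl⟩, rfl⟩
    exact congrArg Submodule.toAddSubgroup h1
  -- With `hker` and `hmap` this reads `[A : F] [A'' : g(A)] = [A' : F'] [A'' : F'']`, where `F` is
  -- the combined lattice.
  have hindex := index_mul_index_range g.toAddMonoidHom F
  rw [hker, hmap] at hindex
  have hne : F.index * g.toAddMonoidHom.range.index ≠ 0 := hindex ▸ mul_ne_zero hF' hF''
  have hF : F.index ≠ 0 := left_ne_zero_of_mul hne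
  refine ⟨right_ne_zero_of_mul hne, ?_⟩
  have e := det_gram_mul_card_sq c B hu hF
  have e' := det_gram_mul_card_sq c B' (linearIndependent_liftBasis A') hF'
  have e'' := det_gram_mul_card_sq c B'' hu'' hF''
  have hdet : (Matrix.of fun i j => c * B (u i) (u j)).det =
      (Matrix.of fun i j => c * B' (b' i) (b' j)).det *
        (Matrix.of fun i j => c * B'' (u'' i) (u'' j)).det := by
    -- Orthogonality of the two halves of `u` makes the Gram matrix block diagonal.
    rw [← Matrix.det_fromBlocks_zero₂₁ _ 0]
    congr 1
    ext (i | i) (j | j) <;> simp [u, u'', h11, h12, h21, h22]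
  have hFL : (F.index : L) ^ 2 ≠ 0 := pow_ne_zero _ (Nat.cast_ne_zero.2 hF)
  have hindexL : (F.index : L) * (g.toAddMonoidHom.range.index : L) = F'.index * F''.index := by
    exact_mod_cast hindex
  refine mul_right_cancel₀ hFL ?_
  rw [hdet] at e
  change _ = _ * (F.index : L) ^ 2 at e
  change _ = _ * (F'.index : L) ^ 2 at e'
  change _ = _ * (F''.index : L) ^ 2 at e''
  set t := (Nat.card (Submodule.torsion ℤ A) : L)
  set t' := (Nat.card (Submodule.torsion ℤ A') : L)
  set t'' := (Nat.card (Submodule.torsion ℤ A'') : L)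
  calc gramDet c B * (t' ^ 2 * t'' ^ 2) * (F.index : L) ^ 2
      = (gramDet c B * (F.index : L) ^ 2) * (t' ^ 2 * t'' ^ 2) := by ring
    _ = ((Matrix.of fun i j => c * B' (b' i) (b' j)).det * t' ^ 2) *
        ((Matrix.of fun i j => c * B'' (u'' i) (u'' j)).det * t'' ^ 2) * t ^ 2 := by
          rw [← e]; ring
    _ = (gramDet c B' * (F'.index : L) ^ 2) * (gramDet c B'' * (F''.index : L) ^ 2) * t ^ 2 := by
          rw [e', e'']
    _ = gramDet c B' * gramDet c B'' * t ^ 2 * ((F'.index : L) * F''.index) ^ 2 := by ring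
    _ = _ := by rw [← hindexL]; ring

end ExactLattice

/-! ### Sections up to an integer, glued pairings, and the formula in terms of indices. -/

section Exact

variable {G : Type} [Group G] {M' M M'' : Type*} [AddCommGroup M'] [AddCommGroup M]
  [AddCommGroup M''] {ρ' : Representation ℤ G M'} {ρ : Representation ℤ G M}
  {ρ'' : Representation ℤ G M''}

/-- A surjection of representations onto a finitely generated one has a section up to a non-zero
integer. -/
theorem exists_section [Finite G] [Module.Finite ℤ M''] (g : ρ.IntertwiningMap ρ'')
    (hg : Function.Surjective g) :
    ∃ (n : ℕ) (s : ρ''.IntertwiningMap ρ), n ≠ 0 ∧ ∀ z, g (s z) = n • z := by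
  have := Fintype.ofFinite G
  let T := Submodule.torsion ℤ M''
  -- `M''` modulo torsion is free, so there is a section modulo torsion; multiplying by the order of
  -- the torsion removes the error.
  obtain ⟨s₀, hs₀⟩ := Module.projective_lifting_property (T.mkQ ∘ₗ g.toLinearMap) LinearMap.id
    (T.mkQ_surjective.comp hg)
  let s₁ : M'' →ₗ[ℤ] M := Nat.card T • (s₀ ∘ₗ T.mkQ)
  have hs₁ : ∀ z, g (s₁ z) = Nat.card T • z := fun z => by
    have h1 : g (s₀ (T.mkQ z)) - z ∈ T := by
      rw [← Submodule.Quotient.mk_eq_zero, ← Submodule.mkQ_apply, map_sub, sub_eq_zero]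
      exact LinearMap.congr_fun hs₀ (T.mkQ z)
    have h2 : Nat.card T • (g (s₀ (T.mkQ z)) - z) = 0 :=
      congrArg Subtype.val (card_nsmul_eq_zero' (x := (⟨_, h1⟩ : T)))
    rw [smul_sub, sub_eq_zero] at h2
    rw [← h2, ← map_nsmul]
    rfl
  -- Summing the conjugates makes the map equivariant, at the cost of a further factor `|G|`.
  let s : M'' →ₗ[ℤ] M := ∑ k : G, ρ k ∘ₗ s₁ ∘ₗ ρ'' k⁻¹
  have hs : ∀ z, s z = ∑ k : G, ρ k (s₁ (ρ'' k⁻¹ z)) := fun z => by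
    simp [s, LinearMap.sum_apply]
  refine ⟨Nat.card G * Nat.card T, ⟨s, fun k => ?_⟩,
    mul_ne_zero Nat.card_pos.ne' Nat.card_pos.ne', fun z => ?_⟩
  · ext z
    change s (ρ'' k z) = ρ k (s z)
    rw [hs, hs, map_sum]
    refine Fintype.sum_equiv (Equiv.mulLeft k⁻¹) _ _ fun j => ?_
    simp [← Module.End.mul_apply, ← map_mul]
  · change g (s z) = _
    have h1 : ∀ k : G, g (ρ k (s₁ (ρ'' k⁻¹ z))) = Nat.card T • z := fun k => by
      rw [Representation.IntertwiningMap.isIntertwining, hs₁, map_nsmul]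
      simp
    rw [hs, map_sum]
    simp [h1, mul_smul]

variable [Module.Finite ℤ M'] [Module.Finite ℤ M] [Module.Finite ℤ M'']

omit [Module.Finite ℤ M] in
theorem card_torsion_inf (H : Subgroup G) : Nat.card ↥(Submodule.torsion ℤ M ⊓ fixed ρ H) =
    Nat.card (Submodule.torsion ℤ (fixed ρ H)) := by
  refine Nat.card_congr ⟨fun x => ⟨⟨x.1, x.2.2⟩, ?_⟩, fun x => ⟨x.1.1, ?_, x.1.2⟩,
    fun _ => rfl, fun _ => rfl⟩
  · obtain ⟨a, ha⟩ := (Submodule.mem_torsion_iff _).1 x.2.1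
    exact (Submodule.mem_torsion_iff _).2 ⟨a, Subtype.ext ha⟩
  · obtain ⟨a, ha⟩ := (Submodule.mem_torsion_iff _).1 x.2
    exact (Submodule.mem_torsion_iff _).2 ⟨a, congrArg Subtype.val ha⟩

/-- The map on fixed submodules induced by a homomorphism of representations. -/
def fixedMap (f : ρ.IntertwiningMap ρ'') (H : Subgroup G) : fixed ρ H →ₗ[ℤ] fixed ρ'' H :=
  f.toLinearMap.restrict fun x hx => mem_fixed.2 fun h hh => by
    change ρ'' h (f x) = f x
    rw [← Representation.IntertwiningMap.isIntertwining, mem_fixed.1 hx h hh]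

/-- Compatible pairings in a short exact sequence. -/
theorem exists_pairings [Finite G] (f : ρ'.IntertwiningMap ρ) (g : ρ.IntertwiningMap ρ'')
    (hf : Function.Injective f) (hfg : Function.Exact f g) (hg : Function.Surjective g)
    (B' : Pairing ρ' ℚ) (B'' : Pairing ρ'' ℚ) :
    ∃ (n : ℕ) (s : ρ''.IntertwiningMap ρ) (B : Pairing ρ ℚ), n ≠ 0 ∧ (∀ z, g (s z) = n • z) ∧
      (∀ x y, B.toBilin (f x) (f y) = B'.toBilin x y) ∧
      (∀ x z, B.toBilin (f x) (s z) = 0) ∧ (∀ z x, B.toBilin (s z) (f x) = 0) ∧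
      ∀ y z, B.toBilin (s y) (s z) = B''.toBilin (g (s y)) (g (s z)) := by
  obtain ⟨n, s, hn, hs⟩ := exists_section g hg
  have hr₀ : ∀ y, n • y - s (g y) ∈ LinearMap.range f.toLinearMap := fun y =>
    (hfg _).1 (by rw [map_sub, hs, map_nsmul, sub_self])
  -- The retraction up to `n` that complements `s`.
  let r : M →ₗ[ℤ] M' := (LinearEquiv.ofInjective f.toLinearMap hf).symm.toLinearMap ∘ₗ
    ((n • LinearMap.id - s.toLinearMap ∘ₗ g.toLinearMap : M →ₗ[ℤ] M).codRestrict _ hr₀)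
  have hr : ∀ y, f (r y) = n • y - s (g y) := fun y =>
    congrArg Subtype.val ((LinearEquiv.ofInjective f.toLinearMap hf).apply_symm_apply ⟨_, hr₀ y⟩)
  have hgf : ∀ x, g (f x) = 0 := fun x => (hfg _).2 ⟨x, rfl⟩
  have hrf : ∀ x, r (f x) = n • x := fun x => hf (by
    rw [hr, hgf, map_zero, sub_zero, map_nsmul])
  have hrs : ∀ z, r (s z) = 0 := fun z => hf (by
    rw [hr, hs, map_nsmul, sub_self, map_zero])
  have hrρ : ∀ k y, r (ρ k y) = ρ' k (r y) := fun k y => hf (by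
    rw [hr, Representation.IntertwiningMap.isIntertwining,
      Representation.IntertwiningMap.isIntertwining,
      Representation.IntertwiningMap.isIntertwining, hr, map_sub, map_nsmul])
  -- Since `r ∘ f = n`, the factor `n⁻²` makes `B` restrict to `B'` along `f`.
  let B : M →ₗ[ℤ] M →ₗ[ℤ] ℚ := (((n : ℚ) ^ 2)⁻¹ • B'.toBilin).compl₁₂ r r +
    B''.toBilin.compl₁₂ g.toLinearMap g.toLinearMap
  have hB : ∀ x y, B x y = ((n : ℚ) ^ 2)⁻¹ * B'.toBilin (r x) (r y) +
    B''.toBilin (g x) (g y) := fun x y => rfl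
  have hnQ : (n : ℚ) ≠ 0 := Nat.cast_ne_zero.2 hn
  have h11 : ∀ x y, B (f x) (f y) = B'.toBilin x y := fun x y => by
    rw [hB, hrf, hrf, hgf, map_zero, map_nsmul, map_nsmul, LinearMap.smul_apply, LinearMap.zero_apply]
    simp only [nsmul_eq_mul]
    field_simp
    ring
  have h12 : ∀ x z, B (f x) (s z) = 0 := fun x z => by rw [hB, hrs, hgf]; simp
  have h21 : ∀ z x, B (s z) (f x) = 0 := fun z x => by rw [hB, hrs, hgf]; simp
  have h22 : ∀ y z, B (s y) (s z) = B''.toBilin (g (s y)) (g (s z)) := fun y z => by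
    rw [hB, hrs]; simp
  refine ⟨n, s, ⟨B, fun k x y => ?_, ?_⟩, hn, hs, h11, h12, h21, h22⟩
  · rw [hB, hB, hrρ, hrρ, B'.invariant, Representation.IntertwiningMap.isIntertwining,
      Representation.IntertwiningMap.isIntertwining, B''.invariant]
  · obtain ⟨hk, h⟩ := gramDet_exact (f := f.toLinearMap) (g := g.toLinearMap) (s := s.toLinearMap)
      hf hfg hn hs 1 h11 h12 h21 h22
    intro h0
    rw [h0, zero_mul] at h
    have ht : (Nat.card (Submodule.torsion ℤ M) : ℚ) ≠ 0 := Nat.cast_ne_zero.2 Nat.card_pos.ne'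
    exact mul_ne_zero (mul_ne_zero (mul_ne_zero B'.nondegenerate B''.nondegenerate)
      (pow_ne_zero 2 ht)) (pow_ne_zero 2 (Nat.cast_ne_zero.2 hk)) h.symm

/-- The regulator constant in a short exact sequence, in terms of the cokernels on fixed
submodules. -/
theorem IsBrauerRelation.regConst_exact [Finite G] [Fintype (Subgroup G)] {Θ : Subgroup G →₀ ℤ}
    (hΘ : IsBrauerRelation Θ) (f : ρ'.IntertwiningMap ρ) (g : ρ.IntertwiningMap ρ'')
    (hf : Function.Injective f) (hfg : Function.Exact f g) (hg : Function.Surjective g) :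
    regConst Θ ρ = regConst Θ ρ' * regConst Θ ρ'' *
      (∏ H, ((fixedMap g H).toAddMonoidHom.range.index : ℚ) ^ Θ H) ^ 2 := by
  let B' := (nonempty_pairing ρ').some
  let B'' := (nonempty_pairing ρ'').some
  obtain ⟨n, s, B, hn, hs, h11, h12, h21, h22⟩ := exists_pairings f g hf hfg hg B' B''
  -- The Brauer relation enters here: the constant of `M` may be computed with the glued pairing.
  -- The rest is an identity for each `H` separately.
  have e := hΘ.regConstOf_eq_regConst B
  rw [Rat.cast_id] at e
  change _ = regConstOf Θ ρ' B' * regConstOf Θ ρ'' B'' * _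
  rw [← e, regConstOf_eq_prod, regConstOf_eq_prod, regConstOf_eq_prod, ← Finset.prod_pow,
    ← Finset.prod_mul_distrib, ← Finset.prod_mul_distrib]
  refine Finset.prod_congr rfl fun H _ => ?_
  rw [← zpow_natCast, zpow_comm, ← mul_zpow, zpow_natCast, ← mul_zpow]
  congr 1
  have hfg' : Function.Exact (fixedMap f H) (fixedMap g H) := fun y => by
    constructor
    · intro hy
      obtain ⟨x, hx⟩ := (hfg y.1).1 (congrArg Subtype.val hy)
      refine ⟨⟨x, mem_fixed.2 fun h hh => hf ?_⟩, Subtype.ext hx⟩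
      rw [Representation.IntertwiningMap.isIntertwining, hx, mem_fixed.1 y.2 h hh]
    · rintro ⟨x, rfl⟩
      exact Subtype.ext ((hfg _).2 ⟨x.1, rfl⟩)
  obtain ⟨-, h⟩ := gramDet_exact (f := fixedMap f H) (g := fixedMap g H) (s := fixedMap s H)
    (B' := B'.onFixed H) (B := B.onFixed H) (B'' := B''.onFixed H)
    (fun x y hxy => Subtype.ext (hf (congrArg Subtype.val hxy))) hfg' hn
    (fun z => Subtype.ext (hs z)) (1 / (Nat.card H : ℚ)) (fun x y => h11 x y)
    (fun x y => h12 x y) (fun x y => h21 x y) (fun x y => h22 x y)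
  simp only [Pairing.factor, card_torsion_inf]
  have ht : (Nat.card (Submodule.torsion ℤ (fixed ρ H)) : ℚ) ≠ 0 :=
    Nat.cast_ne_zero.2 Nat.card_pos.ne'
  have ht' : (Nat.card (Submodule.torsion ℤ (fixed ρ' H)) : ℚ) ≠ 0 :=
    Nat.cast_ne_zero.2 Nat.card_pos.ne'
  have ht'' : (Nat.card (Submodule.torsion ℤ (fixed ρ'' H)) : ℚ) ≠ 0 :=
    Nat.cast_ne_zero.2 Nat.card_pos.ne'
  generalize (Nat.card (Submodule.torsion ℤ (fixed ρ H)) : ℚ) = t at *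
  generalize (Nat.card (Submodule.torsion ℤ (fixed ρ' H)) : ℚ) = t' at *
  generalize (Nat.card (Submodule.torsion ℤ (fixed ρ'' H)) : ℚ) = t'' at *
  rw [one_div_mul_eq_div, one_div_mul_eq_div, one_div_mul_eq_div, div_mul_div_comm,
    div_mul_eq_mul_div, div_eq_div_iff (by positivity) (by positivity), h]
  ring

end Exact

/-! ### Cokernels on invariants as kernels on first cohomology. -/

section Cohomology

/-- In a short exact sequence of representations, the kernel on `H¹` is the cokernel on
invariants. -/
theorem card_ker_map_H1 {k K : Type} [CommRing k] [Group K]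
    {X : ShortComplex (Rep k K)} (hX : X.ShortExact) :
    Nat.card (LinearMap.ker (groupCohomology.map (MonoidHom.id K) X.f 1).hom) =
      ((Rep.invariantsFunctor k K).map X.g).hom.toAddMonoidHom.range.index := by
  -- The connecting map, viewed on the invariants of `X₃`. Its range is the kernel on `H¹` and its
  -- kernel is the image of the invariants of `X₂`.
  let D := (groupCohomology.δ hX 0 1 rfl).hom ∘ₗ (groupCohomology.H0Iso X.X₃).inv.hom
  have h3 := (ShortComplex.moduleCat_exact_iff_range_eq_ker _).1
    (groupCohomology.mapShortComplex₃_exact hX (i := 0) (j := 1) rfl)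
  have h1 := (ShortComplex.moduleCat_exact_iff_range_eq_ker _).1
    (groupCohomology.mapShortComplex₁_exact hX (i := 0) (j := 1) rfl)
  have hsurj : Function.Surjective (groupCohomology.H0Iso X.X₃).inv.hom :=
    (groupCohomology.H0Iso X.X₃).toLinearEquiv.symm.surjective
  have hrange : D.range = LinearMap.ker (groupCohomology.map (MonoidHom.id K) X.f 1).hom := by
    rw [LinearMap.range_comp_of_range_eq_top _ (LinearMap.range_eq_top.2 hsurj)]
    exact h1
  have hker : D.toAddMonoidHom.ker =
      ((Rep.invariantsFunctor k K).map X.g).hom.toAddMonoidHom.range := by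
    ext z
    have h4 : z ∈ D.toAddMonoidHom.ker ↔ (groupCohomology.H0Iso X.X₃).inv z ∈
        LinearMap.range (groupCohomology.map (MonoidHom.id K) X.g 0).hom :=
      (SetLike.ext_iff.1 h3 _).symm
    rw [h4]
    have h5 : ∀ y, (groupCohomology.H0Iso X.X₃).hom
        (groupCohomology.map (MonoidHom.id K) X.g 0 y) =
        (Rep.invariantsFunctor k K).map X.g ((groupCohomology.H0Iso X.X₂).hom y) :=
      fun y => groupCohomology.map_id_comp_H0Iso_hom_apply X.g y
    constructor
    · rintro ⟨y, hy⟩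
      refine ⟨(groupCohomology.H0Iso X.X₂).hom y, (h5 y).symm.trans ?_⟩
      exact (congrArg (groupCohomology.H0Iso X.X₃).hom hy).trans
        ((groupCohomology.H0Iso X.X₃).toLinearEquiv.apply_symm_apply z)
    · rintro ⟨x, hx⟩
      obtain ⟨y, rfl⟩ := (groupCohomology.H0Iso X.X₂).toLinearEquiv.surjective x
      refine ⟨y, ?_⟩
      apply (groupCohomology.H0Iso X.X₃).toLinearEquiv.injective
      refine (h5 y).trans (Eq.trans hx ?_)
      exact ((groupCohomology.H0Iso X.X₃).toLinearEquiv.apply_symm_apply z).symm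
  rw [← hker, AddSubgroup.index_ker, ← hrange]
  rfl

theorem shortExact_of_function_exact {k K : Type} [CommRing k] [Group K]
    {X : ShortComplex (Rep k K)} (hf : Function.Injective X.f.hom)
    (hfg : Function.Exact X.f.hom X.g.hom) (hg : Function.Surjective X.g.hom) : X.ShortExact where
  exact := by
    apply (forget₂ (Rep k K) (ModuleCat k)).reflects_exact_of_faithful
    rw [ShortComplex.moduleCat_exact_iff]
    exact fun x hx => (hfg x).1 hx
  mono_f := (Rep.mono_iff_injective _).2 hf
  epi_g := (Rep.epi_iff_surjective _).2 hg

variable {G : Type} [Group G] {M' M M'' : Type} [AddCommGroup M'] [AddCommGroup M]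
  [AddCommGroup M''] {ρ' : Representation ℤ G M'} {ρ : Representation ℤ G M}
  {ρ'' : Representation ℤ G M''}

theorem card_ker_mapH1 (f : ρ'.IntertwiningMap ρ) (g : ρ.IntertwiningMap ρ'')
    (hf : Function.Injective f) (hfg : Function.Exact f g) (hg : Function.Surjective g)
    (H : Subgroup G) :
    Nat.card (LinearMap.ker (mapH1 f H).hom) = (fixedMap g H).toAddMonoidHom.range.index := by
  let X : ShortComplex (Rep ℤ G) := ShortComplex.mk (Rep.ofHom f) (Rep.ofHom g) (by
    rw [← Rep.ofHom_comp]
    have h : g.comp f = 0 := by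
      ext x
      exact (hfg _).2 ⟨x, rfl⟩
    rw [h]
    rfl)
  have hX : X.ShortExact := shortExact_of_function_exact hf hfg hg
  have h1 := card_ker_map_H1 ((Rep.shortExact_res H.subtype).2 hX)
  have h2 : ((Rep.invariantsFunctor ℤ H).map (X.map (Rep.resFunctor H.subtype)).g).hom =
    fixedMap g H := rfl
  refine Eq.trans ?_ (h1.trans ?_)
  · rfl
  · rfl

theorem psi_eq_prod [Fintype (Subgroup G)] (Θ : Subgroup G →₀ ℤ) (f : ρ'.IntertwiningMap ρ)
    (g : ρ.IntertwiningMap ρ'') (hf : Function.Injective f) (hfg : Function.Exact f g)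
    (hg : Function.Surjective g) :
    psi Θ f = ∏ H, ((fixedMap g H).toAddMonoidHom.range.index : ℚ) ^ Θ H := by
  rw [psi, Finsupp.prod_fintype _ _ fun _ => zpow_zero _]
  simp only [card_ker_mapH1 f g hf hfg hg]

/-- An equivariant section restricts to the `H`-invariants, so in the split case every factor of
`ψ_Θ(f)` is trivial. -/
theorem index_range_fixedMap_of_section {g : ρ.IntertwiningMap ρ''} {s : ρ''.IntertwiningMap ρ}
    (hs : ∀ x, g (s x) = x) (H : Subgroup G) :
    (fixedMap g H).toAddMonoidHom.range.index = 1 := by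
  rw [AddSubgroup.index_eq_one, AddMonoidHom.range_eq_top]
  exact fun x => ⟨fixedMap s H x, Subtype.ext (hs x)⟩

end Cohomology

end RegulatorConstant

end

theorem mainTheorem3 {G : Type} [Group G] [Finite G] (Θ : Subgroup G →₀ ℤ)
    (hΘ : RegulatorConstant.IsBrauerRelation Θ) :
    -- the regulator constant is a non-zero rational number independent of the chosen pairing
    (∀ {N : Type} [AddCommGroup N] [Module.Finite ℤ N] (σ : Representation ℤ G N),
      RegulatorConstant.regConst Θ σ ≠ 0 ∧
      ∀ (L : Type v) [Field L] [CharZero L] (B : RegulatorConstant.Pairing σ L),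
        RegulatorConstant.regConstOf Θ σ B = (RegulatorConstant.regConst Θ σ : L)) ∧
    -- its behaviour in short exact sequences
    (∀ {M' M M'' : Type} [AddCommGroup M'] [AddCommGroup M] [AddCommGroup M'']
      [Module.Finite ℤ M'] [Module.Finite ℤ M] [Module.Finite ℤ M'']
      (ρ' : Representation ℤ G M') (ρ : Representation ℤ G M) (ρ'' : Representation ℤ G M'')
      (f : ρ'.IntertwiningMap ρ) (g : ρ.IntertwiningMap ρ''),
      Function.Injective f → Function.Exact f g → Function.Surjective g →
        RegulatorConstant.regConst Θ ρ =
            RegulatorConstant.regConst Θ ρ' * RegulatorConstant.regConst Θ ρ'' *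
              RegulatorConstant.psi Θ f ^ 2 ∧
          ((∃ s : ρ''.IntertwiningMap ρ, ∀ x, g (s x) = x) →
            RegulatorConstant.regConst Θ ρ =
              RegulatorConstant.regConst Θ ρ' * RegulatorConstant.regConst Θ ρ'')) := by
  have := Fintype.ofFinite (Subgroup G)
  refine ⟨fun σ => ⟨RegulatorConstant.regConstOf_ne_zero Θ _,
    fun L _ _ B => hΘ.regConstOf_eq_regConst B⟩, fun ρ' ρ ρ'' f g hf hfg hg => ⟨?_, ?_⟩⟩
  · rw [RegulatorConstant.psi_eq_prod Θ f g hf hfg hg]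
    exact hΘ.regConst_exact f g hf hfg hg
  · rintro ⟨s, hs⟩
    rw [hΘ.regConst_exact f g hf hfg hg]
    simp [RegulatorConstant.index_range_fixedMap_of_section hs]
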